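/- Let $d\gamma=(2\pi)^{-1/2}e^{-x^2/2}\,dx$ on $\mathbb{R}$. For a measure $\mu$ on $\mathbb{R}$ write $\|g\|_{W^{1,1}(\mathbb{R},\mu)}=\int|g|\,d\mu+\int|g'|\,d\mu$, where $g'$ denotes the weak derivative. (1) For every real $\alpha$ there exists a constant $a_\alpha>0$, depending only on $\alpha$, such that the following holds. Let $f\ge 0$ be a function in $L^1(\mathbb{R},d\gamma)$ with $\sqrt f\in W^{1,2}(\mathbb{R},d\gamma)$ that is normalized and centered, i.e. $\int f\,d\gamma=1$ and $\int x f\,d\gamma=0$, and suppose $\int |x|^2 f\,d\gamma\le\alpha<\infty$. Then the logarithmic Sobolev deficit $$\delta(f)=\frac12\int\frac{|f'|^2}{f}\,d\gamma-\int f\log f\,d\gamma$$ is well defined (both integrals converge absolutely, the first integrand being $0$ where $f=0$) and nonnegative, $f-1\in W^{1,1}(\mathbb{R},d\gamma)$, and $$\|f-1\|_{W^{1,1}(\mathbb{R},d\gamma)}\le a_\alpha\Big(\delta(f)^{1/4}+\delta(f)^{3/4}\Big).$$ (2) For every real $\alpha$ there exists a constant $\overline a_\alpha>0$, depending only on $\alpha$,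 such that the following holds. Let $u\ge 0$ be a function in $W^{1,2}(\mathbb{R},e^{-\pi x^2}dx)$ that is normalized and centered, i.e. $\int u^2e^{-\pi x^2}dx=1$ and $\int x\,u^2e^{-\pi x^2}dx=0$, and suppose $\int |x|^2u^2e^{-\pi x^2}dx\le\alpha<\infty$. Then $$\delta_*(u)=\frac1\pi\int|u'|^2e^{-\pi x^2}dx-\int u^2\log (u^2)\,e^{-\pi x^2}dx$$ is well defined (both integrals converge absolutely) and nonnegative, $u-1\in W^{1,1}(\mathbb{R},e^{-\pi x^2}dx)$, and $$\|u-1\|_{W^{1,1}(\mathbb{R},e^{-\pi x^2}dx)}\le\overline a_\alpha\big(\delta_*(u)^{1/4}+\delta_*(u)\big).$$ -/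

import Mathlib

open MeasureTheory ProbabilityTheory
open scoped ENNReal ContDiff

namespace LSIStability

/-- `g` is a weak (distributional) derivative of `f` on the real line: both are locally integrable
and `∫ f φ' = - ∫ g φ` for every smooth compactly supported test function `φ`. -/
def HasWeakDeriv (f g : ℝ → ℝ) : Prop :=
  LocallyIntegrable f volume ∧ LocallyIntegrable g volume ∧
    ∀ φ : ℝ → ℝ, ContDiff ℝ ∞ φ → HasCompactSupport φ →
      ∫ x, f x * deriv φ x = -∫ x, g x * φ x

/-- A weak derivative is unique up to Lebesgue-null sets. -/
theorem HasWeakDeriv.ae_eq {f g h : ℝ → ℝ} (hg : HasWeakDeriv f g) (hh : HasWeakDeriv f h) :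
    g =ᵐ[volume] h := by
  refine ae_eq_of_integral_contDiff_smul_eq hg.2.1 hh.2.1 fun φ hφ hc => ?_
  have h1 := hg.2.2 φ hφ hc
  have h2 := hh.2.2 φ hφ hc
  simp only [smul_eq_mul, mul_comm (φ _)]
  linarith

open Classical in
/-- The weak derivative of `f` (a choice of representative; `0` if there is none). -/
noncomputable def weakDeriv (f : ℝ → ℝ) : ℝ → ℝ :=
  if h : ∃ g, HasWeakDeriv f g then h.choose else 0

theorem hasWeakDeriv_weakDeriv {f : ℝ → ℝ} (h : ∃ g, HasWeakDeriv f g) :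
    HasWeakDeriv f (weakDeriv f) := by
  rw [weakDeriv, dif_pos h]
  exact h.choose_spec

/-- Membership in the weighted Sobolev space `W^{1,p}(ℝ, μ)`. -/
def MemW1p (p : ℝ≥0∞) (μ : Measure ℝ) (f : ℝ → ℝ) : Prop :=
  MemLp f p μ ∧ ∃ g, HasWeakDeriv f g ∧ MemLp g p μ

/-- The norm `∫ |f| dμ + ∫ |f'| dμ` of `W^{1,1}(ℝ, μ)`. -/
noncomputable def w11Norm (μ : Measure ℝ) (f : ℝ → ℝ) : ℝ :=
  ∫ x, |f x| ∂μ + ∫ x, |weakDeriv f x| ∂μ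

/-- The standard Gaussian measure `dγ = (2π)^{-1/2} e^{-x²/2} dx`. -/
noncomputable def γ : Measure ℝ := gaussianReal 0 1

/-- The Gaussian probability measure `e^{-π x²} dx`. -/
noncomputable def γπ : Measure ℝ :=
  volume.withDensity fun x => ENNReal.ofReal (Real.exp (-Real.pi * x ^ 2))

/-- The integrand `|f'|² / f` of the Fisher information. It is `0` where `f = 0`, by the
convention `a / 0 = 0`. -/
noncomputable def fisherIntegrand (f : ℝ → ℝ) (x : ℝ) : ℝ := weakDeriv f x ^ 2 / f x

/-- The deficit `δ(f) = ½ ∫ |f'|² / f dγ - ∫ f log f dγ`. -/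
noncomputable def deficit (f : ℝ → ℝ) : ℝ :=
  1 / 2 * ∫ x, fisherIntegrand f x ∂γ - ∫ x, f x * Real.log (f x) ∂γ

/-- The deficit `δ_*(u)`, where
`π δ_*(u) = ∫ |u'|² e^{-π x²} dx - π ∫ |u|² log |u|² e^{-π x²} dx`. -/
noncomputable def deficitStar (u : ℝ → ℝ) : ℝ :=
  (∫ x, weakDeriv u x ^ 2 ∂γπ - Real.pi * ∫ x, u x ^ 2 * Real.log (u x ^ 2) ∂γπ) / Real.pi

end LSIStability

/-! The estimates come from the mass-transport proof of the Gaussian logarithmic Sobolev inequality,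
read with its remainder. Let f > 0 be a centered density and T the increasing map pushing f dγ to γ.
Inserting log T' ≤ T' - 1 into the change-of-variables equation and completing a square gives, after
integration, ½ ∫ D² f dγ ≤ δ(f) with D = (log f)' + T - x (`half_integral_disc_sq_le`).

In one dimension D controls how far T is from a translation. Let g be the Gaussian density and ∫ D²
f dγ ≤ e². Since (f g - g∘T)' = D f g, Cauchy-Schwarz on a tail gives |f g - g∘T| ≤ e exp(-T²/4),
that is |T' - 1| ≤ √(2π) e exp(T²/4). Where the right side is at most 1/2, T - x is constant up to
O(e |T| exp(T²/4)), which is integrable because T pushes f dγ to γ; the remaining set has mass O(e²)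
and costs O(e) by Cauchy-Schwarz and the second moments. Centering removes the constant, so ∫ |T -
x| f dγ = O(e) (`integral_abs_displacement_le`). Then f' = (D - (T - x)) f yields ∫ |f'| dγ =
O(δ^{1/2}), which lies below a multiple of δ^{1/4} + δ^{3/4}, and an L¹ Poincaré inequality controls
f - 1.

A density with zeros is written v² and replaced by (v² + t)/(1 + t); all bounds survive t → 0.

For amplitudes, |v'| ≤ |(v²)'| where v² ≥ 1/4. The set v² < 1/4 has measure O(∫ |v² - 1| dγ) =
O(δ^{1/2}), so Cauchy-Schwarz against ∫ |v'|² dγ, itself bounded by the deficit and the second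
moment, produces the power δ^{1/4}. A dilation by √(2π) passes from γ to exp(-πx²) dx. -/

namespace LSIStability

open Set Filter Topology

/-! ### Locally absolutely continuous representatives of weakly differentiable functions -/

/-- `f` is locally absolutely continuous and `f'` is a version of its derivative. -/
structure IsPrimitive (f f' : ℝ → ℝ) : Prop where
  locallyIntegrable : LocallyIntegrable f' volume
  integral_eq_sub : ∀ a b, ∫ x in a..b, f' x = f b - f a

namespace IsPrimitive

variable {f f' g g' : ℝ → ℝ}

theorem intervalIntegrable (h : IsPrimitive f f') (a b : ℝ) :
    IntervalIntegrable f' volume a b :=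
  (h.locallyIntegrable.integrableOn_isCompact isCompact_uIcc).intervalIntegrable

theorem eq_add_integral (h : IsPrimitive f f') (a : ℝ) :
    f = fun x => f a + ∫ t in a..x, f' t := by
  ext x
  rw [h.integral_eq_sub]
  ring

theorem ae_hasDerivAt (h : IsPrimitive f f') : ∀ᵐ x, HasDerivAt f (f' x) x := by
  filter_upwards [LocallyIntegrable.ae_hasDerivAt_integral h.locallyIntegrable] with x hx
  rw [h.eq_add_integral 0]
  exact (hx 0).const_add _

theorem continuous (h : IsPrimitive f f') : Continuous f := by
  rw [h.eq_add_integral 0]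
  exact continuous_const.add
    (intervalIntegral.continuous_primitive (fun a b => h.intervalIntegrable a b) 0)

theorem absolutelyContinuousOnInterval (h : IsPrimitive f f') (a b : ℝ) :
    AbsolutelyContinuousOnInterval f a b := by
  have h1 := (h.intervalIntegrable a b).absolutelyContinuousOnInterval_intervalIntegral
    (c := a) (by simp)
  have h2 : AbsolutelyContinuousOnInterval (fun _ : ℝ => f a) a b :=
    (contDiff_const (n := 1)).contDiffOn.absolutelyContinuousOnInterval
  have h3 := h2.add h1
  rw [h.eq_add_integral a]
  simpa [Pi.add_def] using h3

theorem of_hasDerivAt (h : ∀ x, HasDerivAt f (f' x) x) (hc : Continuous f') :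
    IsPrimitive f f' where
  locallyIntegrable := hc.locallyIntegrable
  integral_eq_sub a b :=
    intervalIntegral.integral_eq_sub_of_hasDerivAt (fun x _ => h x) (hc.intervalIntegrable a b)

theorem const (c : ℝ) : IsPrimitive (fun _ => c) (fun _ => 0) :=
  of_hasDerivAt (fun x => hasDerivAt_const x c) continuous_const

theorem add (hf : IsPrimitive f f') (hg : IsPrimitive g g') :
    IsPrimitive (fun x => f x + g x) (fun x => f' x + g' x) where
  locallyIntegrable := hf.locallyIntegrable.add hg.locallyIntegrable
  integral_eq_sub a b := by
    rw [intervalIntegral.integral_add (hf.intervalIntegrable a b) (hg.intervalIntegrable a b),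
      hf.integral_eq_sub, hg.integral_eq_sub]
    ring

theorem mul (hf : IsPrimitive f f') (hg : IsPrimitive g g') :
    IsPrimitive (fun x => f x * g x) (fun x => f' x * g x + f x * g' x) where
  locallyIntegrable := by
    refine LocallyIntegrable.add ?_ ?_
    · simpa only [smul_eq_mul, mul_comm] using hf.locallyIntegrable.smul_continuous hg.continuous
    · simpa only [smul_eq_mul] using hg.locallyIntegrable.continuous_smul hf.continuous
  integral_eq_sub a b := by
    rw [← (hf.absolutelyContinuousOnInterval a b).integral_deriv_mul_eq_sub
      (hg.absolutelyContinuousOnInterval a b)]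
    refine intervalIntegral.integral_congr_ae ?_
    filter_upwards [hf.ae_hasDerivAt, hg.ae_hasDerivAt] with x h1 h2 _
    rw [h1.deriv, h2.deriv]

theorem const_mul (hf : IsPrimitive f f') (c : ℝ) :
    IsPrimitive (fun x => c * f x) (fun x => c * f' x) where
  locallyIntegrable := by
    simpa only [smul_eq_mul] using hf.locallyIntegrable.continuous_smul (continuous_const (y := c))
  integral_eq_sub a b := by
    rw [intervalIntegral.integral_const_mul, hf.integral_eq_sub]
    ring

theorem sub (hf : IsPrimitive f f') (hg : IsPrimitive g g') :
    IsPrimitive (fun x => f x - g x) (fun x => f' x - g' x) := by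
  convert hf.add (hg.const_mul (-1)) using 2 <;> ring

theorem congr_deriv (hf : IsPrimitive f f') (h : f' = g') : IsPrimitive f g' := h ▸ hf

theorem hasWeakDeriv (hf : IsPrimitive f f') : HasWeakDeriv f f' := by
  refine ⟨hf.continuous.locallyIntegrable, hf.locallyIntegrable, fun φ hφ hc => ?_⟩
  have hd : IsPrimitive φ (deriv φ) :=
    of_hasDerivAt (fun x => (hφ.differentiable (by simp) x).hasDerivAt)
      (hφ.continuous_deriv (by simp))
  have hm := hf.mul hd
  obtain ⟨R, hR, hsub⟩ : ∃ R : ℝ, 0 < R ∧ tsupport φ ⊆ Ioo (-R) R := by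
    obtain ⟨R, hR⟩ := hc.isBounded.subset_ball_lt 0 0
    exact ⟨R, hR.1, by simpa [Real.ball_eq_Ioo] using hR.2⟩
  have hs : ∀ x, x ∉ Ioo (-R) R → φ x = 0 := fun x hx =>
    image_eq_zero_of_notMem_tsupport fun h => hx (hsub h)
  have hs' : ∀ x, x ∉ Ioo (-R) R → deriv φ x = 0 := fun x hx =>
    image_eq_zero_of_notMem_tsupport fun h => hx (hsub (tsupport_deriv_subset h))
  have key := hm.integral_eq_sub (-R) R
  have i1 : IntervalIntegrable (fun x => f' x * φ x) volume (-R) R :=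
    (hf.intervalIntegrable _ _).mul_continuousOn hd.continuous.continuousOn
  have i2 : IntervalIntegrable (fun x => f x * deriv φ x) volume (-R) R :=
    (hd.intervalIntegrable _ _).continuousOn_mul hf.continuous.continuousOn
  rw [intervalIntegral.integral_add i1 i2, hs R (by simp), hs (-R) (by simp),
    intervalIntegral.integral_eq_integral_of_support_subset,
    intervalIntegral.integral_eq_integral_of_support_subset] at key
  · linarith
  · intro x hx
    by_contra h
    exact hx (by simp [hs' x fun h' => h ⟨h'.1, h'.2.le⟩])
  · intro x hx
    by_contra h
    exact hx (by simp [hs x fun h' => h ⟨h'.1, h'.2.le⟩])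

end IsPrimitive

/-- The antiderivative started to the left of the support vanishes again to its right exactly
because the total integral is zero. -/
theorem exists_deriv_eq_of_integral_eq_zero {θ : ℝ → ℝ} (hθ : ContDiff ℝ ∞ θ)
    (hc : HasCompactSupport θ) (h0 : ∫ x, θ x = 0) :
    ∃ φ : ℝ → ℝ, ContDiff ℝ ∞ φ ∧ HasCompactSupport φ ∧ deriv φ = θ := by
  obtain ⟨R, hR, hsub⟩ : ∃ R : ℝ, 0 < R ∧ tsupport θ ⊆ Ioo (-R) R := by
    obtain ⟨R, hR⟩ := hc.isBounded.subset_ball_lt 0 0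
    exact ⟨R, hR.1, by simpa [Real.ball_eq_Ioo] using hR.2⟩
  have hs : ∀ x, x ∉ Ioo (-R) R → θ x = 0 := fun x hx =>
    image_eq_zero_of_notMem_tsupport fun h => hx (hsub h)
  have hd : ∀ x, HasDerivAt (fun x => ∫ t in (-R)..x, θ t) (θ x) x := fun x =>
    hθ.continuous.integral_hasStrictDerivAt _ _ |>.hasDerivAt
  have hde : deriv (fun x => ∫ t in (-R)..x, θ t) = θ := funext fun x => (hd x).deriv
  refine ⟨fun x => ∫ t in (-R)..x, θ t, ?_, ?_, hde⟩
  · rw [contDiff_infty_iff_deriv, hde]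
    exact ⟨fun x => (hd x).differentiableAt, hθ⟩
  · refine HasCompactSupport.of_support_subset_isCompact (isCompact_Icc (a := -R) (b := R)) ?_
    intro x hx
    by_contra h
    apply hx
    rcases lt_or_ge x (-R) with h1 | h1
    · change ∫ t in (-R)..x, θ t = 0
      rw [intervalIntegral.integral_symm, neg_eq_zero]
      refine intervalIntegral.integral_zero_ae (Eventually.of_forall fun t ht => hs t ?_)
      rw [uIoc_of_le h1.le] at ht
      exact fun h' => absurd h'.1 (not_lt.2 ht.2)
    · have h2 : R < x := by
        by_contra h3
        exact h ⟨h1, not_lt.1 h3⟩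
      change ∫ t in (-R)..x, θ t = 0
      rw [intervalIntegral.integral_eq_integral_of_support_subset, h0]
      intro t ht
      by_contra h4
      exact ht (hs t fun h' => h4 ⟨h'.1, (h'.2.trans h2).le⟩)

/-- The du Bois-Reymond lemma. -/
theorem ae_eq_const_of_integral_mul_deriv_eq_zero {h : ℝ → ℝ} (hh : LocallyIntegrable h volume)
    (h0 : ∀ φ : ℝ → ℝ, ContDiff ℝ ∞ φ → HasCompactSupport φ → ∫ x, h x * deriv φ x = 0) :
    ∃ c : ℝ, ∀ᵐ x, h x = c := by
  let B : ContDiffBump (0 : ℝ) := default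
  let χ : ℝ → ℝ := B.normed volume
  have hχ : ContDiff ℝ ∞ χ := B.contDiff_normed
  have hχc : HasCompactSupport χ := B.hasCompactSupport_normed
  have hχ1 : ∫ x, χ x = 1 := B.integral_normed
  have int : ∀ ψ : ℝ → ℝ, ContDiff ℝ ∞ ψ → HasCompactSupport ψ →
      Integrable (fun x => ψ x * h x) := fun ψ hψ hc => by
    simpa only [smul_eq_mul] using
      hh.integrable_smul_left_of_hasCompactSupport hψ.continuous hc
  refine ⟨∫ x, χ x * h x, ae_eq_of_integral_contDiff_smul_eq hh
    (locallyIntegrable_const _) fun ψ hψ hc => ?_⟩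
  have iψ : Integrable ψ := hψ.continuous.integrable_of_hasCompactSupport hc
  have iχ : Integrable χ := hχ.continuous.integrable_of_hasCompactSupport hχc
  -- Subtracting the right multiple of the bump `χ` makes an arbitrary test function mean-free,
  -- hence a derivative.
  obtain ⟨φ, hφ, hφc, hφd⟩ := exists_deriv_eq_of_integral_eq_zero
    (θ := fun x => ψ x - (∫ y, ψ y) * χ x) (hψ.sub (contDiff_const.mul hχ))
    (hc.sub (hχc.mul_left)) (by
      rw [integral_sub iψ (iχ.const_mul _), integral_const_mul, hχ1]; ring)
  have key := h0 φ hφ hφc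
  rw [hφd] at key
  have e : (fun x => h x * (ψ x - (∫ y, ψ y) * χ x)) =
      fun x => ψ x * h x - (∫ y, ψ y) * (χ x * h x) := by
    ext x; ring
  rw [e, integral_sub (int ψ hψ hc) ((int χ hχ hχc).const_mul _), integral_const_mul] at key
  simp only [smul_eq_mul]
  rw [integral_mul_const]
  linarith

/-- A function with a weak derivative has a locally absolutely continuous representative. -/
theorem HasWeakDeriv.exists_isPrimitive {u w : ℝ → ℝ} (h : HasWeakDeriv u w) :
    ∃ v : ℝ → ℝ, v =ᵐ[volume] u ∧ IsPrimitive v w := by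
  have ii : ∀ a b, IntervalIntegrable w volume a b := fun a b =>
    (h.2.1.integrableOn_isCompact isCompact_uIcc).intervalIntegrable
  have hp : IsPrimitive (fun x => ∫ t in (0 : ℝ)..x, w t) w :=
    ⟨h.2.1, fun a b => by
      rw [← intervalIntegral.integral_interval_sub_left (ii 0 b) (ii 0 a)]⟩
  have hw := hp.hasWeakDeriv
  obtain ⟨c, hc⟩ := ae_eq_const_of_integral_mul_deriv_eq_zero (h.1.sub hw.1) fun φ hφ hφc => by
    have hd : Continuous (deriv φ) := hφ.continuous_deriv (by simp)
    have i1 : Integrable (fun x => u x * deriv φ x) := by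
      simpa only [smul_eq_mul] using
        h.1.integrable_smul_right_of_hasCompactSupport hd hφc.deriv
    have i2 : Integrable (fun x => (∫ t in (0 : ℝ)..x, w t) * deriv φ x) := by
      simpa only [smul_eq_mul] using
        hw.1.integrable_smul_right_of_hasCompactSupport hd hφc.deriv
    simp only [Pi.sub_apply, sub_mul]
    rw [integral_sub i1 i2, h.2.2 φ hφ hφc, hw.2.2 φ hφ hφc, sub_self]
  refine ⟨fun x => c + ∫ t in (0 : ℝ)..x, w t, ?_, ?_⟩
  · filter_upwards [hc] with x hx
    rw [Pi.sub_apply] at hx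
    linarith
  · simpa using (IsPrimitive.const c).add hp

/-! ### Distribution functions and monotone transport on the line -/

/-- The distribution function of the density `g`. -/
noncomputable def cumul (g : ℝ → ℝ) (x : ℝ) : ℝ := ∫ t in Iic x, g t

section cumul

variable {g : ℝ → ℝ}

theorem cumul_sub_cumul (hi : Integrable g) (a b : ℝ) :
    cumul g b - cumul g a = ∫ t in a..b, g t :=
  intervalIntegral.integral_Iic_sub_Iic hi.integrableOn hi.integrableOn

theorem cumul_add_integral_Ioi (hi : Integrable g) (x : ℝ) :
    cumul g x + ∫ t in Ioi x, g t = ∫ t, g t :=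
  intervalIntegral.integral_Iic_add_Ioi hi.integrableOn hi.integrableOn

theorem hasDerivAt_cumul (hc : Continuous g) (hi : Integrable g) (x : ℝ) :
    HasDerivAt (cumul g) (g x) x := by
  have h : cumul g = fun y => cumul g 0 + ∫ t in (0 : ℝ)..y, g t := by
    ext y
    rw [← cumul_sub_cumul hi]
    ring
  rw [h]
  exact (hc.integral_hasStrictDerivAt 0 x).hasDerivAt.const_add _

theorem continuous_cumul (hc : Continuous g) (hi : Integrable g) : Continuous (cumul g) :=
  continuous_iff_continuousAt.2 fun x => (hasDerivAt_cumul hc hi x).continuousAt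

theorem strictMono_cumul (hc : Continuous g) (hi : Integrable g) (hp : ∀ x, 0 < g x) :
    StrictMono (cumul g) :=
  strictMono_of_deriv_pos fun x => by
    rw [(hasDerivAt_cumul hc hi x).deriv]
    exact hp x

theorem tendsto_cumul_atTop (hi : Integrable g) :
    Tendsto (cumul g) atTop (𝓝 (∫ t, g t)) := by
  have h := intervalIntegral_tendsto_integral_Ioi 0 hi.integrableOn tendsto_id
  have h2 := h.const_add (cumul g 0)
  rw [cumul_add_integral_Ioi hi] at h2
  refine h2.congr fun y => ?_
  rw [id, ← cumul_sub_cumul hi]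
  ring

theorem tendsto_cumul_atBot (hi : Integrable g) :
    Tendsto (cumul g) atBot (𝓝 0) := by
  have h := intervalIntegral_tendsto_integral_Iic 0 hi.integrableOn tendsto_id
  have h2 := h.const_sub (cumul g 0)
  rw [cumul, sub_self] at h2
  refine h2.congr fun y => ?_
  rw [id, ← cumul_sub_cumul hi, cumul]
  ring

theorem cumul_pos (hc : Continuous g) (hi : Integrable g) (hp : ∀ x, 0 < g x) (x : ℝ) :
    0 < cumul g x :=
  ((strictMono_cumul hc hi hp).monotone.le_of_tendsto (tendsto_cumul_atBot hi) (x - 1)).trans_lt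
    (strictMono_cumul hc hi hp (by linarith))

theorem cumul_lt (hc : Continuous g) (hi : Integrable g) (hp : ∀ x, 0 < g x) (x : ℝ) :
    cumul g x < ∫ t, g t :=
  (strictMono_cumul hc hi hp (lt_add_one x)).trans_le
    ((strictMono_cumul hc hi hp).monotone.ge_of_tendsto (tendsto_cumul_atTop hi) (x + 1))

theorem exists_cumul_eq (hc : Continuous g) (hi : Integrable g) {y : ℝ}
    (h0 : 0 < y) (h1 : y < ∫ t, g t) : ∃ x, cumul g x = y := by
  obtain ⟨a, ha⟩ := ((tendsto_cumul_atBot hi).eventually (gt_mem_nhds h0)).exists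
  obtain ⟨b, hb⟩ := ((tendsto_cumul_atTop hi).eventually (lt_mem_nhds h1)).exists
  exact mem_range_of_exists_le_of_exists_ge (continuous_cumul hc hi) ⟨a, ha.le⟩ ⟨b, hb.le⟩

/-- The monotone transport map between two positive continuous densities. -/
theorem exists_transport {k : ℝ → ℝ} (hc : Continuous g) (hi : Integrable g) (hp : ∀ x, 0 < g x)
    (kc : Continuous k) (ki : Integrable k) (kp : ∀ x, 0 < k x)
    (hgk : ∫ t, g t = ∫ t, k t) :
    ∃ T : ℝ → ℝ, StrictMono T ∧ Function.Surjective T ∧ (∀ x, cumul k (T x) = cumul g x) ∧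
      ∀ x, HasDerivAt T (g x / k (T x)) x := by
  choose T hT using fun x => exists_cumul_eq kc ki (cumul_pos hc hi hp x)
    ((cumul_lt hc hi hp x).trans_eq hgk)
  have hm : StrictMono T := fun x y hxy => by
    rw [← (strictMono_cumul kc ki kp).lt_iff_lt, hT, hT]
    exact strictMono_cumul hc hi hp hxy
  have hs : Function.Surjective T := fun y => by
    obtain ⟨x, hx⟩ := exists_cumul_eq hc hi (cumul_pos kc ki kp y)
      ((cumul_lt kc ki kp y).trans_eq hgk.symm)
    exact ⟨x, (strictMono_cumul kc ki kp).injective ((hT x).trans hx)⟩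
  -- A monotone surjection of the line is continuous. With this, the slope of `T` is the quotient of
  -- the slopes of the two distribution functions, and no inverse function theorem is needed.
  have hcont : Continuous T := hm.monotone.continuous_of_surjective hs
  refine ⟨T, hm, hs, hT, fun x => ?_⟩
  rw [hasDerivAt_iff_tendsto_slope]
  have h1 := hasDerivAt_iff_tendsto_slope.1 (hasDerivAt_cumul hc hi x)
  have h2 := hasDerivAt_iff_tendsto_slope.1 (hasDerivAt_cumul kc ki (T x))
  have h3 : Tendsto T (𝓝[≠] x) (𝓝[≠] (T x)) :=
    tendsto_nhdsWithin_of_tendsto_nhds_of_eventually_within _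
      (hcont.continuousAt.mono_left nhdsWithin_le_nhds)
      (eventually_nhdsWithin_of_forall fun y hy => hm.injective.ne hy)
  refine (h1.div (h2.comp h3) (kp _).ne').congr' ?_
  filter_upwards [self_mem_nhdsWithin] with y hy
  have e1 : y - x ≠ 0 := sub_ne_zero.2 hy
  have e2 : T y - T x ≠ 0 := sub_ne_zero.2 (hm.injective.ne hy)
  have e3 : cumul g y - cumul g x ≠ 0 :=
    sub_ne_zero.2 ((strictMono_cumul hc hi hp).injective.ne hy)
  simp only [Pi.div_apply, Function.comp, slope_def_field, hT]
  field_simp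

end cumul

/-! ### The Gaussian density, its moments and its tails -/

/-- The standard Gaussian density. -/
noncomputable def gdens (x : ℝ) : ℝ := (√(2 * Real.pi))⁻¹ * Real.exp (-x ^ 2 / 2)

theorem gaussianPDFReal_eq_gdens : gaussianPDFReal 0 1 = gdens := by
  ext x
  simp [gaussianPDFReal, gdens]

theorem gdens_pos (x : ℝ) : 0 < gdens x := by
  unfold gdens
  positivity

@[fun_prop]
theorem continuous_gdens : Continuous gdens := by
  unfold gdens
  fun_prop

theorem hasDerivAt_gdens (x : ℝ) : HasDerivAt gdens (-x * gdens x) x := by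
  have h : HasDerivAt (fun x : ℝ => -x ^ 2 / 2) (-x) x :=
    ((hasDerivAt_pow 2 x).fun_neg.div_const 2).congr_deriv (by simp; ring)
  refine (h.exp.const_mul (√(2 * Real.pi))⁻¹).congr_deriv ?_
  unfold gdens
  ring

theorem integrable_gdens : Integrable gdens :=
  gaussianPDFReal_eq_gdens ▸ integrable_gaussianPDFReal 0 1

theorem integral_gdens : ∫ x, gdens x = 1 :=
  gaussianPDFReal_eq_gdens ▸ integral_gaussianPDFReal_eq_one 0 one_ne_zero

theorem sqrt_two_pi_mul_gdens (x : ℝ) : √(2 * Real.pi) * gdens x = Real.exp (-x ^ 2 / 2) := by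
  unfold gdens
  rw [mul_inv_cancel_left₀]
  positivity

theorem γ_eq_withDensity : γ = volume.withDensity fun x => ENNReal.ofReal (gdens x) := by
  rw [γ, gaussianReal_of_var_ne_zero 0 one_ne_zero]
  congr 1
  ext x
  rw [gaussianPDF, gaussianPDFReal_eq_gdens]

instance : IsProbabilityMeasure γ := by
  unfold γ
  infer_instance

theorem ae_γ_eq : ae γ = ae (volume : Measure ℝ) := by
  refine le_antisymm ?_ ?_
  · exact (gaussianReal_absolutelyContinuous 0 one_ne_zero).ae_le
  · exact (gaussianReal_absolutelyContinuous' 0 one_ne_zero).ae_le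

theorem integral_γ (f : ℝ → ℝ) : ∫ x, f x ∂γ = ∫ x, gdens x * f x := by
  rw [γ, integral_gaussianReal_eq_integral_smul one_ne_zero, gaussianPDFReal_eq_gdens]
  rfl

theorem integrable_γ_iff {f : ℝ → ℝ} : Integrable f γ ↔ Integrable fun x => gdens x * f x := by
  rw [γ_eq_withDensity, integrable_withDensity_iff_integrable_smul' (by fun_prop) (by simp)]
  simp only [ENNReal.toReal_ofReal (gdens_pos _).le, smul_eq_mul]

theorem integrable_sq_γ : Integrable (fun x : ℝ => x ^ 2) γ :=
  (memLp_id_gaussianReal 2).integrable_sq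

theorem integrable_id_γ : Integrable (fun x : ℝ => x) γ :=
  (memLp_id_gaussianReal 1).integrable (by simp)

theorem integral_id_γ : ∫ x, x ∂γ = 0 := integral_id_gaussianReal

theorem integral_sq_γ : ∫ x, x ^ 2 ∂γ = 1 := by
  have h := variance_fun_id_gaussianReal (μ := 0) (v := 1)
  rw [variance_eq_integral (by fun_prop)] at h
  simpa [γ] using h

theorem integral_Ioi_gdens_le {t : ℝ} (ht : 0 ≤ t) :
    ∫ x in Ioi t, gdens x ≤ Real.exp (-t ^ 2 / 2) := by
  have h1 : ∫ x in Ioi t, gdens x = ∫ x in Ioi 0, gdens (x + t) := by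
    have h := (measurePreserving_add_right volume t).setIntegral_preimage_emb
      (measurableEmbedding_addRight t) gdens (Ioi t)
    rw [← h]
    simp
  rw [h1]
  have h2 : ∫ x in Ioi 0, gdens (x + t) ≤ ∫ x in Ioi 0, Real.exp (-t ^ 2 / 2) * gdens x := by
    refine setIntegral_mono_on ((integrable_gdens.comp_add_right t).integrableOn)
      (integrable_gdens.const_mul _).integrableOn measurableSet_Ioi fun x hx => ?_
    -- For x, t ≥ 0, (x + t)² ≥ x² + t².
    unfold gdens
    rw [mul_left_comm, ← Real.exp_add]
    gcongr
    nlinarith [mul_nonneg (mem_Ioi.1 hx).le ht]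
  refine h2.trans ?_
  rw [integral_const_mul]
  have h3 : ∫ x in Ioi 0, gdens x ≤ 1 := by
    rw [← integral_gdens]
    exact setIntegral_le_integral integrable_gdens (Eventually.of_forall fun x => (gdens_pos x).le)
  nlinarith [Real.exp_pos (-t ^ 2 / 2)]

theorem gdens_neg (x : ℝ) : gdens (-x) = gdens x := by
  unfold gdens
  rw [neg_sq]

theorem cumul_gdens_le {t : ℝ} (ht : t ≤ 0) : cumul gdens t ≤ Real.exp (-t ^ 2 / 2) := by
  have h : cumul gdens t = ∫ x in Ioi (-t), gdens x := by
    rw [cumul, ← integral_comp_neg_Iic]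
    simp only [gdens_neg]
  rw [h]
  simpa using integral_Ioi_gdens_le (neg_nonneg.2 ht)

theorem one_sub_cumul_gdens (t : ℝ) : 1 - cumul gdens t = ∫ x in Ioi t, gdens x := by
  rw [← integral_gdens, ← cumul_add_integral_Ioi integrable_gdens t]
  ring

theorem one_sub_cumul_gdens_le {t : ℝ} (ht : 0 ≤ t) :
    1 - cumul gdens t ≤ Real.exp (-t ^ 2 / 2) :=
  (one_sub_cumul_gdens t).trans_le (integral_Ioi_gdens_le ht)

theorem cumul_gdens_pos (t : ℝ) : 0 < cumul gdens t :=
  cumul_pos continuous_gdens integrable_gdens gdens_pos t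

theorem cumul_gdens_lt_one (t : ℝ) : cumul gdens t < 1 :=
  (cumul_lt continuous_gdens integrable_gdens gdens_pos t).trans_eq integral_gdens

theorem isPrimitive_cumul_gdens : IsPrimitive (cumul gdens) gdens :=
  .of_hasDerivAt (hasDerivAt_cumul continuous_gdens integrable_gdens) continuous_gdens

/-! ### An L¹ Poincaré inequality for the Gaussian measure -/

section Poincare

variable {f f' : ℝ → ℝ}

theorem IsPrimitive.norm_sub_le (h : IsPrimitive f f') {a b : ℝ} (hab : a ≤ b) :
    |f b - f a| ≤ ∫ t in a..b, |f' t| := by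
  rw [← h.integral_eq_sub]
  exact intervalIntegral.abs_integral_le_integral_abs hab

theorem locallyIntegrable_abs {f : ℝ → ℝ} (h : LocallyIntegrable f volume) :
    LocallyIntegrable (fun x => |f x|) volume := fun x => by
  obtain ⟨s, hs, hi⟩ := h x
  exact ⟨s, hs, hi.abs⟩

theorem isPrimitive_integral {f' : ℝ → ℝ} (h : LocallyIntegrable f' volume) :
    IsPrimitive (fun x => ∫ t in (0 : ℝ)..x, f' t) f' := by
  have ii : ∀ a b, IntervalIntegrable f' volume a b := fun a b =>
    (h.integrableOn_isCompact isCompact_uIcc).intervalIntegrable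
  exact ⟨h, fun a b => by rw [← intervalIntegral.integral_interval_sub_left (ii 0 b) (ii 0 a)]⟩

theorem intervalIntegral_le_integral {k : ℝ → ℝ} (hk : Integrable k) (h0 : ∀ x, 0 ≤ k x)
    {a b : ℝ} (hab : a ≤ b) : ∫ x in a..b, k x ≤ ∫ x, k x := by
  rw [intervalIntegral.integral_of_le hab]
  exact setIntegral_le_integral hk (Eventually.of_forall h0)

/-- The `L¹` Poincaré inequality for the Gaussian measure, anchored at the origin. -/
theorem integral_abs_sub_zero_le (h : IsPrimitive f f') (hf : Integrable f γ)
    (hf' : Integrable f' γ) :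
    ∫ x, |f x - f 0| ∂γ ≤ 2 * √(2 * Real.pi) * ∫ x, |f' x| ∂γ := by
  have hG := isPrimitive_integral (locallyIntegrable_abs h.locallyIntegrable)
  set G : ℝ → ℝ := fun x => ∫ t in (0 : ℝ)..x, |f' t| with hGdef
  have hG0 : G 0 = 0 := by simp [hGdef]
  have hi' : Integrable (fun x => gdens x * |f' x|) := integrable_γ_iff.1 hf'.abs
  have hnn : ∀ x, 0 ≤ gdens x * |f' x| := fun x => mul_nonneg (gdens_pos x).le (abs_nonneg _)
  set M := ∫ x, gdens x * |f' x| with hM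
  have hsq : 0 < √(2 * Real.pi) := by positivity
  -- On each half line |f - f 0| is dominated by the primitive of |f'|. Integrating by parts against
  -- the Gaussian tail leaves a boundary term of favourable sign, and the tail is at most
  -- exp(-x²/2), that is √(2π) times the density.
  have right : ∀ R : ℝ, 0 ≤ R → ∫ x in (0 : ℝ)..R, gdens x * |f x - f 0| ≤
      √(2 * Real.pi) * M := fun R hR => by
    have hp := hG.mul ((IsPrimitive.const 1).sub isPrimitive_cumul_gdens)
    have e := hp.integral_eq_sub 0 R
    have i1 : IntervalIntegrable (fun x => gdens x * G x) volume 0 R :=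
      (continuous_gdens.mul hG.continuous).intervalIntegrable _ _
    have i2 : IntervalIntegrable (fun x => √(2 * Real.pi) * (gdens x * |f' x|)) volume 0 R :=
      (hi'.const_mul _).intervalIntegrable
    have hGR : 0 ≤ G R := intervalIntegral.integral_nonneg hR fun x _ => abs_nonneg _
    calc ∫ x in (0 : ℝ)..R, gdens x * |f x - f 0|
        ≤ ∫ x in (0 : ℝ)..R, gdens x * G x := by
          refine intervalIntegral.integral_mono_on hR
            ((continuous_gdens.mul (h.continuous.sub continuous_const).abs).intervalIntegrable _ _)
            i1 fun x hx => mul_le_mul_of_nonneg_left (h.norm_sub_le hx.1) (gdens_pos x).le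
      _ ≤ ∫ x in (0 : ℝ)..R, √(2 * Real.pi) * (gdens x * |f' x|) := by
          rw [← sub_nonneg, ← intervalIntegral.integral_sub i2 i1]
          have e2 : 0 ≤ ∫ x in (0 : ℝ)..R,
              (|f' x| * (1 - cumul gdens x) + G x * (0 - gdens x)) := by
            rw [e, hG0, zero_mul, sub_zero]
            exact mul_nonneg hGR (by linarith [cumul_gdens_lt_one R])
          refine e2.trans (intervalIntegral.integral_mono_on hR (hp.intervalIntegrable 0 R)
            (i2.sub i1) fun x hx => ?_)
          have := mul_le_mul_of_nonneg_left (one_sub_cumul_gdens_le hx.1) (abs_nonneg (f' x))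
          rw [← sqrt_two_pi_mul_gdens] at this
          linarith
      _ ≤ √(2 * Real.pi) * M := by
          rw [intervalIntegral.integral_const_mul]
          exact mul_le_mul_of_nonneg_left (intervalIntegral_le_integral hi' hnn hR) hsq.le
  have left : ∀ R : ℝ, 0 ≤ R → ∫ x in (-R)..0, gdens x * |f x - f 0| ≤
      √(2 * Real.pi) * M := fun R hR => by
    have hR' : -R ≤ 0 := by linarith
    have hp := hG.mul isPrimitive_cumul_gdens
    have e := hp.integral_eq_sub (-R) 0
    have i1 : IntervalIntegrable (fun x => gdens x * -G x) volume (-R) 0 :=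
      (continuous_gdens.mul hG.continuous.neg).intervalIntegrable _ _
    have i2 : IntervalIntegrable (fun x => √(2 * Real.pi) * (gdens x * |f' x|)) volume (-R) 0 :=
      (hi'.const_mul _).intervalIntegrable
    have hGR : ∀ x ≤ 0, -G x = ∫ t in x..0, |f' t| := fun x _ => by
      rw [hGdef, ← intervalIntegral.integral_symm]
    calc ∫ x in (-R)..0, gdens x * |f x - f 0|
        ≤ ∫ x in (-R)..0, gdens x * -G x := by
          refine intervalIntegral.integral_mono_on hR'
            ((continuous_gdens.mul (h.continuous.sub continuous_const).abs).intervalIntegrable _ _)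
            i1 fun x hx => mul_le_mul_of_nonneg_left ?_ (gdens_pos x).le
          rw [hGR x hx.2, abs_sub_comm]
          exact h.norm_sub_le hx.2
      _ ≤ ∫ x in (-R)..0, √(2 * Real.pi) * (gdens x * |f' x|) := by
          rw [← sub_nonneg, ← intervalIntegral.integral_sub i2 i1]
          have e2 : 0 ≤ ∫ x in (-R)..0, (|f' x| * cumul gdens x + G x * gdens x) := by
            rw [e, hG0, zero_mul, zero_sub, ← neg_mul, hGR _ hR']
            exact mul_nonneg (intervalIntegral.integral_nonneg hR' fun x _ => abs_nonneg _)
              (cumul_gdens_pos _).le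
          refine e2.trans (intervalIntegral.integral_mono_on hR' (hp.intervalIntegrable _ _)
            (i2.sub i1) fun x hx => ?_)
          have := mul_le_mul_of_nonneg_left (cumul_gdens_le hx.2) (abs_nonneg (f' x))
          rw [← sqrt_two_pi_mul_gdens] at this
          linarith
      _ ≤ √(2 * Real.pi) * M := by
          rw [intervalIntegral.integral_const_mul]
          exact mul_le_mul_of_nonneg_left (intervalIntegral_le_integral hi' hnn hR') hsq.le
  have hint : Integrable (fun x => gdens x * |f x - f 0|) :=
    integrable_γ_iff.1 (hf.sub (integrable_const _)).abs
  rw [integral_γ, integral_γ, ← hM]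
  have lim := intervalIntegral_tendsto_integral hint tendsto_neg_atTop_atBot tendsto_id
  refine le_of_tendsto lim ?_
  filter_upwards [eventually_ge_atTop 0] with R hR
  rw [id, ← intervalIntegral.integral_add_adjacent_intervals (b := 0)
    hint.intervalIntegrable hint.intervalIntegrable]
  linarith [left R hR, right R hR]

/-- The `L¹` Poincaré inequality for the Gaussian measure. -/
theorem integral_abs_sub_mean_le (h : IsPrimitive f f') (hf : Integrable f γ)
    (hf' : Integrable f' γ) :
    ∫ x, |f x - ∫ y, f y ∂γ| ∂γ ≤ 4 * √(2 * Real.pi) * ∫ x, |f' x| ∂γ := by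
  have h0 := integral_abs_sub_zero_le h hf hf'
  have hi : Integrable (fun x => f x - f 0) γ := hf.sub (integrable_const _)
  have h1 : |(∫ y, f y ∂γ) - f 0| ≤ ∫ x, |f x - f 0| ∂γ := by
    have e : (∫ y, f y ∂γ) - f 0 = ∫ y, (f y - f 0) ∂γ := by
      rw [integral_sub hf (integrable_const _)]
      simp
    rw [e]
    exact abs_integral_le_integral_abs
  have h2 : ∫ x, |f x - ∫ y, f y ∂γ| ∂γ ≤
      ∫ x, (|f x - f 0| + |(∫ y, f y ∂γ) - f 0|) ∂γ := by
    refine integral_mono (hf.sub (integrable_const _)).abs (hi.abs.add (integrable_const _))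
      fun x => ?_
    have := abs_sub (f x - f 0) ((∫ y, f y ∂γ) - f 0)
    simpa using this
  rw [integral_add hi.abs (integrable_const _)] at h2
  simp only [integral_const, probReal_univ, one_smul] at h2
  linarith

end Poincare

/-! ### Weighted Cauchy-Schwarz, decay along sequences, exceptional Gaussian sets -/

/-- The Cauchy-Schwarz inequality for weighted integrals. -/
theorem sq_integral_abs_mul_le {Ω : Type*} [MeasurableSpace Ω] {μ : Measure Ω} {u v w : Ω → ℝ}
    (hw : ∀ x, 0 ≤ w x) (hu : Integrable (fun x => u x ^ 2 * w x) μ)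
    (hv : Integrable (fun x => v x ^ 2 * w x) μ)
    (huv : Integrable (fun x => |u x * v x| * w x) μ) :
    (∫ x, |u x * v x| * w x ∂μ) ^ 2 ≤ (∫ x, u x ^ 2 * w x ∂μ) * ∫ x, v x ^ 2 * w x ∂μ := by
  -- The quadratic in t is the integral of (|u| t + |v|)² w, so its discriminant is nonpositive.
  have h : ∀ t : ℝ, 0 ≤ (∫ x, u x ^ 2 * w x ∂μ) * (t * t) + 2 * (∫ x, |u x * v x| * w x ∂μ) * t +
      ∫ x, v x ^ 2 * w x ∂μ := fun t => by
    have e : (∫ x, u x ^ 2 * w x ∂μ) * (t * t) + 2 * (∫ x, |u x * v x| * w x ∂μ) * t +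
        ∫ x, v x ^ 2 * w x ∂μ = ∫ x, (|u x| * t + |v x|) ^ 2 * w x ∂μ := by
      rw [← integral_mul_const, mul_right_comm 2 _ t, ← integral_const_mul,
        ← integral_add (hu.mul_const _) (huv.const_mul _), ← integral_add (f := fun x =>
          u x ^ 2 * w x * (t * t) + 2 * t * (|u x * v x| * w x))
          ((hu.mul_const _).add (huv.const_mul _)) hv]
      refine integral_congr_ae (Eventually.of_forall fun x => ?_)
      simp only [abs_mul]
      rw [← sq_abs (u x), ← sq_abs (v x)]
      ring
    rw [e]
    exact integral_nonneg fun x => mul_nonneg (sq_nonneg _) (hw x)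
  have := discrim_le_zero h
  rw [discrim] at this
  nlinarith

/-- A set on which |k| exceeds a positive constant has finite measure and so contains no half line.
This disposes of boundary terms at infinity, where no pointwise decay is available. -/
theorem exists_seq_tendsto_zero_atTop {k : ℝ → ℝ} (hk : Integrable k) :
    ∃ b : ℕ → ℝ, Tendsto b atTop atTop ∧ Tendsto (fun n => k (b n)) atTop (𝓝 0) := by
  have h : ∀ n : ℕ, ∃ x : ℝ, (n : ℝ) ≤ x ∧ |k x| < 1 / ((n : ℝ) + 1) := fun n => by
    by_contra! hcon
    have hpos : (0 : ℝ) < 1 / ((n : ℝ) + 1) := by positivity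
    have h1 := hk.measure_norm_ge_lt_top hpos
    have h2 : Ici (n : ℝ) ⊆ {x | 1 / ((n : ℝ) + 1) ≤ ‖k x‖} := fun x hx => hcon x hx
    have h3 := (measure_mono h2).trans_lt h1
    simp at h3
  choose b hb1 hb2 using h
  refine ⟨b, tendsto_atTop_mono hb1 tendsto_natCast_atTop_atTop, ?_⟩
  exact squeeze_zero_norm (fun n => (hb2 n).le) tendsto_one_div_add_atTop_nhds_zero_nat

theorem exists_seq_tendsto_zero_atBot {k : ℝ → ℝ} (hk : Integrable k) :
    ∃ a : ℕ → ℝ, Tendsto a atTop atBot ∧ Tendsto (fun n => k (a n)) atTop (𝓝 0) := by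
  obtain ⟨b, hb1, hb2⟩ := exists_seq_tendsto_zero_atTop hk.comp_neg
  exact ⟨fun n => -b n, tendsto_neg_atTop_atBot.comp hb1, hb2⟩

theorem tendsto_gdens_atTop : Tendsto gdens atTop (𝓝 0) := by
  have h1 : Tendsto (fun x : ℝ => -x ^ 2 / 2) atTop atBot := by
    have := (tendsto_pow_atTop (α := ℝ) two_ne_zero).atTop_div_const (zero_lt_two (α := ℝ))
    refine (tendsto_neg_atTop_atBot.comp this).congr fun x => ?_
    simp [neg_div]
  have h2 := (Real.tendsto_exp_atBot.comp h1).const_mul (√(2 * Real.pi))⁻¹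
  rwa [mul_zero] at h2

theorem tendsto_gdens_atBot : Tendsto gdens atBot (𝓝 0) := by
  refine (tendsto_gdens_atTop.comp tendsto_neg_atBot_atTop).congr fun x => ?_
  simp [gdens_neg]

theorem log_gdens (x : ℝ) : Real.log (gdens x) = Real.log (√(2 * Real.pi))⁻¹ - x ^ 2 / 2 := by
  rw [gdens, Real.log_mul (by positivity) (Real.exp_ne_zero _), Real.log_exp]
  ring

/-- The set where `κ exp (y² / 4)` is large has Gaussian measure `O(κ²)`. -/
theorem measureReal_tail_le {κ : ℝ} (hκ : 0 < κ) :
    γ.real {y | 1 / 2 < κ * Real.exp (y ^ 2 / 4)} ≤ 8 * κ ^ 2 := by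
  rcases le_or_gt 1 (2 * κ) with h1 | h1
  · have := measureReal_le_one (μ := γ) (s := {y | 1 / 2 < κ * Real.exp (y ^ 2 / 4)})
    nlinarith
  -- `R` solves κ exp(R²/4) = 1/2, so exp(-R²/2) = (2κ)² and the two tails add up to 8κ².
  set L := Real.log (1 / (2 * κ)) with hL
  have hL0 : 0 ≤ L := Real.log_nonneg (by rw [le_div_iff₀ (by positivity)]; linarith)
  set R := 2 * √L with hR
  have hR0 : 0 ≤ R := by positivity
  have hR2 : R ^ 2 = 4 * L := by
    rw [hR, mul_pow, Real.sq_sqrt hL0]; norm_num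
  have hexp : Real.exp (-R ^ 2 / 2) = 4 * κ ^ 2 := by
    have e : -R ^ 2 / 2 = -L + -L := by rw [hR2]; ring
    rw [e, Real.exp_add, Real.exp_neg, hL, Real.exp_log (by positivity)]
    field_simp
    norm_num
  have hsub : {y | 1 / 2 < κ * Real.exp (y ^ 2 / 4)} ⊆ Iic (-R) ∪ Ioi R := fun y hy => by
    have h2 : 1 / (2 * κ) < Real.exp (y ^ 2 / 4) := by
      rw [div_lt_iff₀ (by positivity)]
      have := mem_ofPred_eq.mp hy
      linarith
    rw [← Real.log_lt_iff_lt_exp (by positivity)] at h2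
    by_contra h3
    rw [mem_union, mem_Iic, mem_Ioi, not_or, not_le, not_lt] at h3
    nlinarith [abs_le.2 ⟨h3.1.le, h3.2⟩]
  have key : ∀ s : Set ℝ, MeasurableSet s → γ.real s = ∫ x in s, gdens x := fun s hs => by
    rw [← integral_indicator_one hs, integral_γ, ← integral_indicator hs]
    refine integral_congr_ae (Eventually.of_forall fun x => ?_)
    by_cases hx : x ∈ s <;> simp [hx]
  calc γ.real {y | 1 / 2 < κ * Real.exp (y ^ 2 / 4)}
      ≤ γ.real (Iic (-R) ∪ Ioi R) := measureReal_mono hsub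
    _ ≤ γ.real (Iic (-R)) + γ.real (Ioi R) := measureReal_union_le _ _
    _ ≤ Real.exp (-R ^ 2 / 2) + Real.exp (-R ^ 2 / 2) := by
        rw [key _ measurableSet_Iic, key _ measurableSet_Ioi]
        have := cumul_gdens_le (neg_nonpos.2 hR0)
        rw [neg_sq] at this
        exact add_le_add this (integral_Ioi_gdens_le hR0)
    _ = 8 * κ ^ 2 := by rw [hexp]; ring

theorem integrable_abs_mul_exp_γ : Integrable (fun y : ℝ => |y| * Real.exp (y ^ 2 / 4)) γ := by
  rw [integrable_γ_iff]
  have h := (integrable_mul_exp_neg_mul_sq (b := 1 / 4) (by norm_num)).abs.const_mul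
    (√(2 * Real.pi))⁻¹
  refine h.congr (Eventually.of_forall fun y => ?_)
  simp only [gdens, abs_mul, Real.abs_exp]
  have : Real.exp (-(1 / 4) * y ^ 2) = Real.exp (-y ^ 2 / 2) * Real.exp (y ^ 2 / 4) := by
    rw [← Real.exp_add]; congr 1; ring
  rw [this]
  ring

/-! ### Positive densities and their transport to the Gaussian -/

/-- A positive, locally absolutely continuous, centered probability density with respect to the
Gaussian measure, with finite second moment and finite Fisher information. -/
structure IsPosDensity (f f' : ℝ → ℝ) : Prop where
  prim : IsPrimitive f f'
  pos : ∀ x, 0 < f x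
  integrable : Integrable f γ
  integral_eq_one : ∫ x, f x ∂γ = 1
  centered : ∫ x, x * f x ∂γ = 0
  second_moment : Integrable (fun x => x ^ 2 * f x) γ
  fisher : Integrable (fun x => f' x ^ 2 / f x) γ

/-- The density with respect to Lebesgue measure. -/
noncomputable def wt (f : ℝ → ℝ) (x : ℝ) : ℝ := gdens x * f x

theorem integral_γ_mul_eq_wt (f k : ℝ → ℝ) : ∫ x, k x * f x ∂γ = ∫ x, k x * wt f x := by
  rw [integral_γ]
  refine integral_congr_ae (Eventually.of_forall fun x => ?_)
  simp only [wt]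
  ring

theorem integrable_γ_mul_iff_wt {f k : ℝ → ℝ} :
    Integrable (fun x => k x * f x) γ ↔ Integrable fun x => k x * wt f x := by
  rw [integrable_γ_iff]
  have : (fun x => gdens x * (k x * f x)) = fun x => k x * wt f x := by
    ext x
    simp only [wt]
    ring
  rw [this]

/-- `T` is the monotone map transporting `f dγ` to `γ`. -/
structure IsTransport (f T : ℝ → ℝ) : Prop where
  strictMono : StrictMono T
  surjective : Function.Surjective T
  cumul_eq : ∀ x, cumul gdens (T x) = cumul (wt f) x
  hasDerivAt : ∀ x, HasDerivAt T (wt f x / gdens (T x)) x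

/-- The discrepancy `(log f)' + T - x`. -/
noncomputable def disc (f f' T : ℝ → ℝ) (x : ℝ) : ℝ := f' x / f x + T x - x

namespace IsPosDensity

variable {f f' T : ℝ → ℝ}

theorem wt_pos (h : IsPosDensity f f') (x : ℝ) : 0 < wt f x := mul_pos (gdens_pos x) (h.pos x)

theorem continuous_wt (h : IsPosDensity f f') : Continuous (wt f) :=
  continuous_gdens.mul h.prim.continuous

theorem integrable_wt (h : IsPosDensity f f') : Integrable (wt f) := integrable_γ_iff.1 h.integrable

theorem integral_wt (h : IsPosDensity f f') : ∫ x, wt f x = 1 := by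
  rw [← h.integral_eq_one, integral_γ]
  rfl

theorem exists_isTransport (h : IsPosDensity f f') : ∃ T, IsTransport f T := by
  obtain ⟨T, h1, h2, h3, h4⟩ := exists_transport h.continuous_wt h.integrable_wt h.wt_pos
    continuous_gdens integrable_gdens gdens_pos (h.integral_wt.trans integral_gdens.symm)
  exact ⟨T, h1, h2, h3, h4⟩

theorem isPrimitive_wt (h : IsPosDensity f f') :
    IsPrimitive (wt f) (fun x => (f' x / f x - x) * wt f x) := by
  refine ((IsPrimitive.of_hasDerivAt hasDerivAt_gdens (by fun_prop)).mul h.prim).congr_deriv ?_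
  ext x
  have := (h.pos x).ne'
  simp only [wt]
  field_simp
  ring

theorem integrable_score_sq (h : IsPosDensity f f') :
    Integrable (fun x => (f' x / f x) ^ 2 * wt f x) := by
  rw [← integrable_γ_mul_iff_wt]
  refine h.fisher.congr (Eventually.of_forall fun x => ?_)
  have := (h.pos x).ne'
  simp only
  field_simp

theorem integral_score_sq (h : IsPosDensity f f') :
    ∫ x, (f' x / f x) ^ 2 * wt f x = ∫ x, f' x ^ 2 / f x ∂γ := by
  rw [← integral_γ_mul_eq_wt]
  refine integral_congr_ae (Eventually.of_forall fun x => ?_)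
  have := (h.pos x).ne'
  simp only
  field_simp

theorem integrable_sq_mul_wt (h : IsPosDensity f f') : Integrable (fun x => x ^ 2 * wt f x) :=
  integrable_γ_mul_iff_wt.1 h.second_moment

end IsPosDensity

namespace IsTransport

variable {f f' T : ℝ → ℝ}

theorem continuous (hT : IsTransport f T) : Continuous T :=
  continuous_iff_continuousAt.2 fun x => (hT.hasDerivAt x).continuousAt

theorem tendsto_atTop (hT : IsTransport f T) : Tendsto T atTop atTop :=
  tendsto_atTop_atTop_of_monotone hT.strictMono.monotone fun b =>
    (hT.surjective b).imp fun _ h => h.ge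

theorem tendsto_atBot (hT : IsTransport f T) : Tendsto T atBot atBot :=
  tendsto_atBot_atBot_of_monotone hT.strictMono.monotone fun b =>
    (hT.surjective b).imp fun _ h => h.le

theorem continuous_deriv (hT : IsTransport f T) (h : IsPosDensity f f') :
    Continuous fun x => wt f x / gdens (T x) :=
  h.continuous_wt.div (continuous_gdens.comp hT.continuous) fun _ => (gdens_pos _).ne'

theorem deriv_pos (h : IsPosDensity f f') (x : ℝ) : 0 < wt f x / gdens (T x) :=
  div_pos (h.wt_pos x) (gdens_pos _)

theorem abs_deriv_smul (h : IsPosDensity f f') (k : ℝ → ℝ) :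
    (fun x => |wt f x / gdens (T x)| • (gdens (T x) * k (T x))) = fun x => k (T x) * wt f x := by
  ext x
  have := (gdens_pos (T x)).ne'
  rw [abs_of_pos (deriv_pos h x), smul_eq_mul]
  field_simp

theorem integrable_comp_iff (hT : IsTransport f T) (h : IsPosDensity f f') {k : ℝ → ℝ} :
    Integrable (fun x => k (T x) * wt f x) ↔ Integrable k γ := by
  have := integrableOn_image_iff_integrableOn_abs_deriv_smul MeasurableSet.univ
    (fun x _ => (hT.hasDerivAt x).hasDerivWithinAt) hT.strictMono.injective.injOn
    (fun x => gdens x * k x)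
  rw [abs_deriv_smul h, image_univ, hT.surjective.range_eq, integrableOn_univ,
    integrableOn_univ] at this
  rw [← this, integrable_γ_iff]

theorem integral_comp (hT : IsTransport f T) (h : IsPosDensity f f') (k : ℝ → ℝ) :
    ∫ x, k (T x) * wt f x = ∫ x, k x ∂γ := by
  have := integral_image_eq_integral_abs_deriv_smul MeasurableSet.univ
    (fun x _ => (hT.hasDerivAt x).hasDerivWithinAt) hT.strictMono.injective.injOn
    (fun x => gdens x * k x)
  rw [abs_deriv_smul h, image_univ, hT.surjective.range_eq, setIntegral_univ,
    setIntegral_univ] at this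
  rw [← this, integral_γ]

end IsTransport

/-! ### The transport proof of the logarithmic Sobolev inequality, with remainder -/

section core

variable {f f' T : ℝ → ℝ} (h : IsPosDensity f f') (hT : IsTransport f T)

include h

theorem integrable_mul_wt : Integrable (fun x => x * wt f x) := by
  refine (h.integrable_wt.add h.integrable_sq_mul_wt).mono'
    (continuous_id.mul h.continuous_wt).aestronglyMeasurable (Eventually.of_forall fun x => ?_)
  have := h.wt_pos x
  rw [Real.norm_eq_abs, abs_mul, abs_of_pos this, Pi.add_apply, ← sq_abs x]
  nlinarith [sq_nonneg (|x| - 1), abs_nonneg x]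

theorem integral_mul_wt : ∫ x, x * wt f x = 0 := by
  rw [← integral_γ_mul_eq_wt, h.centered]

include hT

theorem integrable_transport_mul_wt : Integrable (fun x => T x * wt f x) :=
  (hT.integrable_comp_iff h (k := fun x => x)).2 integrable_id_γ

theorem integral_transport_mul_wt : ∫ x, T x * wt f x = 0 :=
  (hT.integral_comp h fun x => x).trans integral_id_γ

theorem integrable_transport_sq_mul_wt : Integrable (fun x => T x ^ 2 * wt f x) :=
  (hT.integrable_comp_iff h (k := fun x => x ^ 2)).2 integrable_sq_γ

theorem integral_transport_sq_mul_wt : ∫ x, T x ^ 2 * wt f x = 1 :=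
  (hT.integral_comp h fun x => x ^ 2).trans integral_sq_γ

theorem integrable_displacement : Integrable (fun x => (T x - x) * wt f x) := by
  refine ((integrable_transport_mul_wt h hT).sub (integrable_mul_wt h)).congr
    (Eventually.of_forall fun x => ?_)
  simp only [Pi.sub_apply, sub_mul]

theorem integral_displacement : ∫ x, (T x - x) * wt f x = 0 := by
  simp only [sub_mul]
  rw [integral_sub (integrable_transport_mul_wt h hT) (integrable_mul_wt h),
    integral_transport_mul_wt h hT, integral_mul_wt h, sub_zero]

omit hT in
theorem displacement_sq_le (x : ℝ) :
    (T x - x) ^ 2 * wt f x ≤ 2 * (T x ^ 2 * wt f x + x ^ 2 * wt f x) := by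
  nlinarith [h.wt_pos x, mul_nonneg (sq_nonneg (T x + x)) (h.wt_pos x).le]

theorem integrable_displacement_sq : Integrable (fun x => (T x - x) ^ 2 * wt f x) := by
  refine (((integrable_transport_sq_mul_wt h hT).add h.integrable_sq_mul_wt).const_mul 2).mono'
    (((hT.continuous.sub continuous_id).pow 2).mul h.continuous_wt).aestronglyMeasurable
    (Eventually.of_forall fun x => ?_)
  rw [Real.norm_eq_abs, abs_of_nonneg (mul_nonneg (sq_nonneg _) (h.wt_pos x).le)]
  exact displacement_sq_le h x

theorem integral_displacement_sq_le :
    ∫ x, (T x - x) ^ 2 * wt f x ≤ 2 * (1 + ∫ x, x ^ 2 * f x ∂γ) := by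
  rw [← integral_transport_sq_mul_wt h hT, integral_γ_mul_eq_wt,
    ← integral_add (integrable_transport_sq_mul_wt h hT) h.integrable_sq_mul_wt,
    ← integral_const_mul]
  exact integral_mono (integrable_displacement_sq h hT)
    (((integrable_transport_sq_mul_wt h hT).add h.integrable_sq_mul_wt).const_mul 2)
    (displacement_sq_le h)

omit hT in
theorem aestronglyMeasurable_score : AEStronglyMeasurable (fun x => f' x / f x) volume :=
  h.prim.locallyIntegrable.aestronglyMeasurable.div₀
    h.prim.continuous.aestronglyMeasurable

theorem aestronglyMeasurable_disc : AEStronglyMeasurable (disc f f' T) volume :=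
  ((aestronglyMeasurable_score h).add hT.continuous.aestronglyMeasurable).sub
    continuous_id.aestronglyMeasurable

theorem integrable_disc_sq : Integrable (fun x => disc f f' T x ^ 2 * wt f x) := by
  refine ((h.integrable_score_sq.add (integrable_displacement_sq h hT)).const_mul 2).mono'
    (((aestronglyMeasurable_disc h hT).pow 2).mul h.continuous_wt.aestronglyMeasurable)
    (Eventually.of_forall fun x => ?_)
  rw [Real.norm_eq_abs, abs_of_nonneg (mul_nonneg (sq_nonneg _) (h.wt_pos x).le)]
  simp only [Pi.add_apply, disc]
  nlinarith [h.wt_pos x, mul_nonneg (sq_nonneg (f' x / f x - (T x - x))) (h.wt_pos x).le]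

theorem integrable_abs_disc : Integrable (fun x => |disc f f' T x| * wt f x) := by
  refine (h.integrable_wt.add (integrable_disc_sq h hT)).mono'
    ((aestronglyMeasurable_disc h hT).norm.mul h.continuous_wt.aestronglyMeasurable)
    (Eventually.of_forall fun x => ?_)
  have := h.wt_pos x
  rw [Real.norm_eq_abs, abs_mul, abs_of_pos this, Pi.add_apply, ← sq_abs (disc f f' T x), abs_abs]
  nlinarith [sq_nonneg (|disc f f' T x| - 1), abs_nonneg (disc f f' T x)]

theorem isPrimitive_flux :
    IsPrimitive (fun x => wt f x * (T x - x)) (fun x => (f' x / f x - x) * wt f x * (T x - x) +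
      wt f x * (wt f x / gdens (T x) - 1)) :=
  h.isPrimitive_wt.mul ((IsPrimitive.of_hasDerivAt hT.hasDerivAt (hT.continuous_deriv h)).sub
    (.of_hasDerivAt hasDerivAt_id' continuous_const))

omit hT in
/-- The pointwise inequality behind the transport proof of the logarithmic Sobolev inequality. -/
theorem half_disc_sq_le (x : ℝ) :
    1 / 2 * (disc f f' T x ^ 2 * wt f x) + gdens x * (f x * Real.log (f x)) ≤
      1 / 2 * ((f' x / f x) ^ 2 * wt f x) + ((f' x / f x - x) * wt f x * (T x - x) +
        wt f x * (wt f x / gdens (T x) - 1)) := by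
  -- With T' = `wt f x / gdens (T x)`, completing the square shows that the right side minus the
  -- left side is exactly (T' - 1 - log T') times `wt f x`.
  have h1 := Real.log_le_sub_one_of_pos (IsTransport.deriv_pos (T := T) h x)
  have h2 : Real.log (wt f x / gdens (T x)) = Real.log (f x) + (T x ^ 2 - x ^ 2) / 2 := by
    rw [Real.log_div (h.wt_pos x).ne' (gdens_pos _).ne', wt,
      Real.log_mul (gdens_pos x).ne' (h.pos x).ne', log_gdens, log_gdens]
    ring
  have h3 : gdens x * (f x * Real.log (f x)) = Real.log (f x) * wt f x := by
    simp only [wt]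
    ring
  rw [h2] at h1
  rw [h3, disc]
  have h4 := mul_le_mul_of_nonneg_right h1 (h.wt_pos x).le
  nlinarith

omit hT in
theorem continuous_entropy : Continuous fun x => gdens x * (f x * Real.log (f x)) :=
  continuous_gdens.mul (h.prim.continuous.mul
    (h.prim.continuous.log fun x => (h.pos x).ne'))

theorem intervalIntegral_disc_sq_le {a b : ℝ} (hab : a ≤ b) :
    (∫ x in a..b, 1 / 2 * (disc f f' T x ^ 2 * wt f x)) +
        ∫ x in a..b, gdens x * (f x * Real.log (f x)) ≤
      (∫ x in a..b, 1 / 2 * ((f' x / f x) ^ 2 * wt f x)) +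
        (wt f b * (T b - b) - wt f a * (T a - a)) := by
  have hp := isPrimitive_flux h hT
  have i1 := ((integrable_disc_sq h hT).const_mul (1 / 2)).intervalIntegrable (a := a) (b := b)
  have i2 := (continuous_entropy h).intervalIntegrable (μ := volume) a b
  have i3 := (h.integrable_score_sq.const_mul (1 / 2)).intervalIntegrable (a := a) (b := b)
  rw [← hp.integral_eq_sub, ← intervalIntegral.integral_add i1 i2,
    ← intervalIntegral.integral_add i3 (hp.intervalIntegrable a b)]
  exact intervalIntegral.integral_mono_on hab (i1.add i2) (i3.add (hp.intervalIntegrable a b))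
    fun x _ => half_disc_sq_le h x

/-- The flux `wt f x * (T x - x)` is integrable because both second moments are finite, hence small
along suitable sequences of endpoints. -/
theorem exists_exhaustion : ∃ a b : ℕ → ℝ, Tendsto a atTop atBot ∧ Tendsto b atTop atTop ∧
    Tendsto (fun n => wt f (b n) * (T (b n) - b n) - wt f (a n) * (T (a n) - a n)) atTop (𝓝 0) := by
  have hi := integrable_displacement h hT
  obtain ⟨a, ha1, ha2⟩ := exists_seq_tendsto_zero_atBot hi
  obtain ⟨b, hb1, hb2⟩ := exists_seq_tendsto_zero_atTop hi
  refine ⟨a, b, ha1, hb1, ?_⟩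
  simpa only [mul_comm, sub_zero] using hb2.sub ha2

theorem integrable_entropy : Integrable (fun x => f x * Real.log (f x)) γ := by
  obtain ⟨a, b, ha, hb, hab⟩ := exists_exhaustion h hT
  rw [integrable_γ_iff]
  -- Since f log f ≥ f - 1 > -1, adding the Gaussian density makes the integrand nonnegative; bounds
  -- on an exhausting sequence of intervals then suffice for integrability.
  set k : ℝ → ℝ := fun x => gdens x * (f x * Real.log (f x)) + gdens x with hk
  have hk0 : ∀ x, 0 ≤ k x := fun x => by
    have h1 := Real.one_sub_inv_le_log_of_pos (h.pos x)
    have h2 : f x - 1 ≤ f x * Real.log (f x) := by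
      have := mul_le_mul_of_nonneg_left h1 (h.pos x).le
      rwa [mul_sub, mul_one, mul_inv_cancel₀ (h.pos x).ne'] at this
    have := mul_nonneg (gdens_pos x).le (by linarith [h.pos x] : 0 ≤ f x * Real.log (f x) + 1)
    simp only [hk]
    linarith
  have hkc : Continuous k := (continuous_entropy h).add continuous_gdens
  obtain ⟨M, hM⟩ := hab.bddAbove_range
  have hki : Integrable k := by
    refine integrable_of_intervalIntegral_norm_bounded
      (1 / 2 * (∫ x, (f' x / f x) ^ 2 * wt f x) + M + 1)
      (fun n => (hkc.integrableOn_Icc.mono_set Ioc_subset_Icc_self)) ha hb ?_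
    filter_upwards [ha.eventually_le_atBot 0, hb.eventually_ge_atTop 0] with n h1 h2
    have hle := h1.trans h2
    have h3 := intervalIntegral_disc_sq_le h hT hle
    have h4 : 0 ≤ ∫ x in (a n)..(b n), 1 / 2 * (disc f f' T x ^ 2 * wt f x) :=
      intervalIntegral.integral_nonneg hle fun x _ =>
        mul_nonneg (by norm_num) (mul_nonneg (sq_nonneg _) (h.wt_pos x).le)
    have h5 := intervalIntegral_le_integral (h.integrable_score_sq.const_mul (1 / 2))
      (fun x => mul_nonneg (by norm_num) (mul_nonneg (sq_nonneg _) (h.wt_pos x).le)) hle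
    rw [integral_const_mul] at h5
    have h6 := hM (mem_range_self n)
    have h7 := intervalIntegral_le_integral integrable_gdens (fun x => (gdens_pos x).le) hle
    rw [integral_gdens] at h7
    have h8 : ∫ x in (a n)..(b n), ‖k x‖ = (∫ x in (a n)..(b n), gdens x * (f x * Real.log (f x))) +
        ∫ x in (a n)..(b n), gdens x := by
      rw [← intervalIntegral.integral_add ((continuous_entropy h).intervalIntegrable _ _)
        (continuous_gdens.intervalIntegrable _ _)]
      exact intervalIntegral.integral_congr fun x _ => Real.norm_of_nonneg (hk0 x)
    rw [h8]
    linarith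
  refine (hki.sub integrable_gdens).congr (Eventually.of_forall fun x => ?_)
  simp only [hk, Pi.sub_apply, add_sub_cancel_right]

/-- The deficit in the logarithmic Sobolev inequality controls the discrepancy. -/
theorem half_integral_disc_sq_le :
    1 / 2 * ∫ x, disc f f' T x ^ 2 * wt f x ≤
      1 / 2 * (∫ x, f' x ^ 2 / f x ∂γ) - ∫ x, f x * Real.log (f x) ∂γ := by
  obtain ⟨a, b, ha, hb, hab⟩ := exists_exhaustion h hT
  have l1 := intervalIntegral_tendsto_integral ((integrable_disc_sq h hT).const_mul (1 / 2)) ha hb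
  have l2 := intervalIntegral_tendsto_integral
    (integrable_γ_iff.1 (integrable_entropy h hT)) ha hb
  have l3 := intervalIntegral_tendsto_integral (h.integrable_score_sq.const_mul (1 / 2)) ha hb
  have key := le_of_tendsto_of_tendsto (l1.add l2) (l3.add hab) (by
    filter_upwards [ha.eventually_le_atBot 0, hb.eventually_ge_atTop 0] with n h1 h2
    exact intervalIntegral_disc_sq_le h hT (h1.trans h2))
  rw [integral_const_mul, integral_const_mul, h.integral_score_sq, ← integral_γ] at key
  linarith

end core

/-! ### From the discrepancy to the displacement T - x -/

section displacement

variable {f f' T : ℝ → ℝ} (h : IsPosDensity f f') (hT : IsTransport f T)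

include h hT

/-- The relation T' · `gdens (T x)` = `wt f x` turns the derivative of `gdens ∘ T` into `-T x * wt f
x`, while `wt f` has logarithmic derivative f'/f - x. This is how smallness of the discrepancy
becomes closeness of T' to 1. -/
theorem isPrimitive_wt_sub_gdens :
    IsPrimitive (fun x => wt f x - gdens (T x)) (fun x => disc f f' T x * wt f x) := by
  have h1 : IsPrimitive (fun x => gdens (T x)) (fun x => -T x * wt f x) := by
    refine IsPrimitive.of_hasDerivAt (fun x => ?_) (hT.continuous.neg.mul h.continuous_wt)
    refine ((hasDerivAt_gdens (T x)).comp x (hT.hasDerivAt x)).congr_deriv ?_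
    have := (gdens_pos (T x)).ne'
    field_simp
  refine (h.isPrimitive_wt.sub h1).congr_deriv ?_
  ext x
  simp only [disc]
  ring

theorem sq_setIntegral_abs_disc_le {e : ℝ} (he : ∫ x, disc f f' T x ^ 2 * wt f x ≤ e ^ 2)
    (s : Set ℝ) :
    (∫ x in s, |disc f f' T x| * wt f x) ^ 2 ≤ e ^ 2 * ∫ x in s, wt f x := by
  have h1 := sq_integral_abs_mul_le (μ := volume.restrict s) (u := disc f f' T) (v := fun _ => 1)
    (w := wt f) (fun x => (h.wt_pos x).le) (integrable_disc_sq h hT).integrableOn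
    (by simp only [one_pow, one_mul]; exact h.integrable_wt.integrableOn)
    (by simp only [mul_one]; exact (integrable_abs_disc h hT).integrableOn)
  simp only [mul_one, one_pow, one_mul] at h1
  refine h1.trans (mul_le_mul_of_nonneg_right (le_trans ?_ he)
    (integral_nonneg fun x => (h.wt_pos x).le))
  exact setIntegral_le_integral (integrable_disc_sq h hT)
    (Eventually.of_forall fun x => mul_nonneg (sq_nonneg _) (h.wt_pos x).le)

theorem integral_abs_disc_le {e : ℝ} (he0 : 0 ≤ e)
    (he : ∫ x, disc f f' T x ^ 2 * wt f x ≤ e ^ 2) : ∫ x, |disc f f' T x| * wt f x ≤ e := by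
  have := sq_setIntegral_abs_disc_le h hT he univ
  rw [setIntegral_univ, setIntegral_univ, h.integral_wt, mul_one] at this
  exact abs_le_of_sq_le_sq' this he0 |>.2

/-- Integrate the discrepancy over the tail on the side of the sign of `T x`. By transport this tail
has the Gaussian mass beyond `T x`, at most exp(-T²/2), and Cauchy-Schwarz yields its square root.
The contribution at infinity vanishes along a sequence. -/
theorem abs_wt_sub_gdens_le {e : ℝ} (he0 : 0 ≤ e)
    (he : ∫ x, disc f f' T x ^ 2 * wt f x ≤ e ^ 2) (x : ℝ) :
    |wt f x - gdens (T x)| ≤ e * Real.exp (-T x ^ 2 / 4) := by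
  have hp := isPrimitive_wt_sub_gdens h hT
  have hi := integrable_abs_disc h hT
  have hnn : ∀ y, 0 ≤ |disc f f' T y| * wt f y := fun y =>
    mul_nonneg (abs_nonneg _) (h.wt_pos y).le
  have hab : ∀ a b, a ≤ b →
      |∫ y in a..b, disc f f' T y * wt f y| ≤ ∫ y in a..b, |disc f f' T y| * wt f y :=
    fun a b hab => by
      refine (intervalIntegral.abs_integral_le_integral_abs hab).trans_eq ?_
      refine intervalIntegral.integral_congr fun y _ => ?_
      simp only [abs_mul, abs_of_pos (h.wt_pos y)]
  have hexp : Real.exp (-T x ^ 2 / 4) ^ 2 = Real.exp (-T x ^ 2 / 2) := by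
    rw [← Real.exp_nat_mul]
    congr 1
    push_cast
    ring
  have fin : ∀ s : Set ℝ, ∫ y in s, wt f y ≤ Real.exp (-T x ^ 2 / 2) →
      ∫ y in s, |disc f f' T y| * wt f y ≤ e * Real.exp (-T x ^ 2 / 4) := fun s hs => by
    refine (abs_le_of_sq_le_sq' ?_ (mul_nonneg he0 (Real.exp_pos _).le)).2
    rw [mul_pow, hexp]
    exact (sq_setIntegral_abs_disc_le h hT he s).trans
      (mul_le_mul_of_nonneg_left hs (sq_nonneg _))
  rcases le_total (T x) 0 with hx | hx
  · obtain ⟨a, ha, hga⟩ := exists_seq_tendsto_zero_atBot h.integrable_wt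
    have hKa := tendsto_gdens_atBot.comp (hT.tendsto_atBot.comp ha)
    have lim : Tendsto (fun n => |wt f x - gdens (T x) - (wt f (a n) - gdens (T (a n)))|) atTop
        (𝓝 |wt f x - gdens (T x) - (0 - 0)|) := (tendsto_const_nhds.sub (hga.sub hKa)).abs
    simp only [sub_zero] at lim
    refine (le_of_tendsto lim ?_).trans (fin (Iic x) ?_)
    · filter_upwards [ha.eventually_le_atBot x] with n hn
      rw [← hp.integral_eq_sub (a n) x]
      refine (hab _ _ hn).trans ?_
      rw [intervalIntegral.integral_of_le hn]
      exact setIntegral_mono_set hi.integrableOn (Eventually.of_forall hnn)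
        Ioc_subset_Iic_self.eventuallyLE
    · exact (hT.cumul_eq x).symm.trans_le (cumul_gdens_le hx)
  · obtain ⟨b, hb, hgb⟩ := exists_seq_tendsto_zero_atTop h.integrable_wt
    have hKb := tendsto_gdens_atTop.comp (hT.tendsto_atTop.comp hb)
    have lim : Tendsto (fun n => |wt f (b n) - gdens (T (b n)) - (wt f x - gdens (T x))|) atTop
        (𝓝 |0 - 0 - (wt f x - gdens (T x))|) := ((hgb.sub hKb).sub tendsto_const_nhds).abs
    simp only [sub_zero, zero_sub, abs_neg] at lim
    refine (le_of_tendsto lim ?_).trans (fin (Ioi x) ?_)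
    · filter_upwards [hb.eventually_ge_atTop x] with n hn
      rw [← hp.integral_eq_sub x (b n)]
      refine (hab _ _ hn).trans ?_
      rw [intervalIntegral.integral_of_le hn]
      exact setIntegral_mono_set hi.integrableOn (Eventually.of_forall hnn)
        Ioc_subset_Ioi_self.eventuallyLE
    · have h1 := cumul_add_integral_Ioi h.integrable_wt x
      rw [h.integral_wt, ← hT.cumul_eq] at h1
      linarith [one_sub_cumul_gdens_le hx]

theorem abs_deriv_transport_sub_one_le {e : ℝ} (he0 : 0 ≤ e)
    (he : ∫ x, disc f f' T x ^ 2 * wt f x ≤ e ^ 2) (x : ℝ) :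
    |wt f x / gdens (T x) - 1| ≤ √(2 * Real.pi) * e * Real.exp (T x ^ 2 / 4) := by
  have hK := gdens_pos (T x)
  rw [div_sub_one hK.ne', abs_div, abs_of_pos hK, div_le_iff₀ hK]
  refine (abs_wt_sub_gdens_le h hT he0 he x).trans_eq ?_
  have e1 : √(2 * Real.pi) * e * Real.exp (T x ^ 2 / 4) * gdens (T x) =
      e * (Real.exp (T x ^ 2 / 4) * (√(2 * Real.pi) * gdens (T x))) := by ring
  rw [e1, sqrt_two_pi_mul_gdens, ← Real.exp_add]
  ring_nf

theorem abs_displacement_le {e x₀ x : ℝ} (he0 : 0 ≤ e)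
    (he : ∫ x, disc f f' T x ^ 2 * wt f x ≤ e ^ 2) (h0 : T x₀ = 0)
    (hx : √(2 * Real.pi) * e * Real.exp (T x ^ 2 / 4) ≤ 1 / 2) :
    |T x - x + x₀| ≤ 2 * (√(2 * Real.pi) * e) * (|T x| * Real.exp (T x ^ 2 / 4)) := by
  set q := √(2 * Real.pi) * e * Real.exp (T x ^ 2 / 4) with hq
  -- Between x₀ and x monotonicity gives |T z| ≤ |T x|, so the bound on |T' - 1| at x holds on the
  -- whole segment.
  have hbound : ∀ z ∈ uIcc x₀ x, ‖wt f z / gdens (T z) - 1‖ ≤ q := fun z hz => by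
    refine (abs_deriv_transport_sub_one_le h hT he0 he z).trans ?_
    have hz2 : T z ^ 2 ≤ T x ^ 2 := by
      rw [sq_le_sq]
      have hm := hT.strictMono.monotone
      rcases mem_uIcc.1 hz with ⟨h1, h2⟩ | ⟨h1, h2⟩
      · have h3 := hm h1
        have h4 := hm h2
        rw [h0] at h3
        rwa [abs_of_nonneg h3, abs_of_nonneg (h3.trans h4)]
      · have h3 := hm h1
        have h4 := hm h2
        rw [h0] at h4
        rw [abs_of_nonpos h4, abs_of_nonpos (h3.trans h4)]
        linarith
    rw [hq]
    gcongr
  have hmv := (convex_uIcc x₀ x).norm_image_sub_le_of_norm_hasDerivWithin_le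
    (f := fun z => T z - z)
    (fun z _ => ((hT.hasDerivAt z).sub (hasDerivAt_id' z)).hasDerivWithinAt) hbound
    left_mem_uIcc right_mem_uIcc
  rw [h0, Real.norm_eq_abs, Real.norm_eq_abs] at hmv
  have e1 : T x - x - (0 - x₀) = T x - x + x₀ := by ring
  rw [e1] at hmv
  have h2 : |x - x₀| ≤ |T x| + |T x - x + x₀| := by
    have e2 : x - x₀ = T x - (T x - x + x₀) := by ring
    rw [e2]
    exact abs_sub _ _
  have hq0 : 0 ≤ q := by positivity
  -- Since q ≤ 1/2, the term q |T x - x + x₀| is absorbed into the left side.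
  have h3 : |T x - x + x₀| ≤ 2 * q * |T x| := by
    nlinarith [mul_le_mul_of_nonneg_left h2 hq0,
      mul_le_mul_of_nonneg_right hx (abs_nonneg (T x - x + x₀))]
  rw [hq] at h3
  linarith

/-- T is compared with the translation by -x₀, where T x₀ = 0. Off the set κ exp(T²/4) > 1/2 the
pointwise bound applies; on it, of mass at most 8κ², Cauchy-Schwarz does. Centering makes the mean
of T - x vanish, so |x₀| is at most the L¹ deviation from that translation. -/
theorem integral_abs_displacement_le {e : ℝ} (he0 : 0 < e)
    (he : ∫ x, disc f f' T x ^ 2 * wt f x ≤ e ^ 2) :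
    ∫ x, |T x - x| * wt f x ≤ √(2 * Real.pi) * e *
      (8 * (∫ y, |y| * Real.exp (y ^ 2 / 4) ∂γ) + 12 * √(∫ x, (T x - x) ^ 2 * wt f x)) := by
  obtain ⟨x₀, h0⟩ := hT.surjective 0
  set κ := √(2 * Real.pi) * e with hκ
  have hκ0 : 0 < κ := by positivity
  set P := ∫ x, (T x - x) ^ 2 * wt f x with hP
  set c := ∫ y, |y| * Real.exp (y ^ 2 / 4) ∂γ with hc
  have hc0 : 0 ≤ c := integral_nonneg fun y => by positivity
  have hP0 : 0 ≤ P := integral_nonneg fun x => mul_nonneg (sq_nonneg _) (h.wt_pos x).le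
  have hw := fun x => (h.wt_pos x).le
  have iP := integrable_displacement_sq h hT
  have i1 := integrable_displacement h hT
  have iabs : Integrable fun x => |T x - x| * wt f x := by
    refine i1.abs.congr (Eventually.of_forall fun x => ?_)
    simp only [abs_mul, abs_of_pos (h.wt_pos x)]
  -- the trivial bound
  have triv : ∫ x, |T x - x| * wt f x ≤ √P := by
    have := sq_integral_abs_mul_le (u := fun x => T x - x) (v := fun _ => 1) hw iP
      (by simpa using h.integrable_wt) (by simpa using iabs)
    simp only [mul_one, one_pow, one_mul, h.integral_wt] at this
    exact Real.le_sqrt_of_sq_le this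
  -- For κ > 1/6 the bound √P is already below 12 κ √P; for κ ≤ 1/6 the term 3κ|x₀| can be absorbed
  -- at the end.
  rcases lt_or_ge (1 / 6) κ with hbig | hsmall
  · refine triv.trans ?_
    nlinarith [Real.sqrt_nonneg P, mul_nonneg hκ0.le hc0,
      mul_le_mul_of_nonneg_right hbig.le (Real.sqrt_nonneg P)]
  -- the deviation from the translation by `x₀`
  have iY : Integrable fun x => |T x - x + x₀| * wt f x := by
    have := (i1.add (h.integrable_wt.const_mul x₀)).abs
    refine this.congr (Eventually.of_forall fun x => ?_)
    simp only [Pi.add_apply]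
    rw [← add_mul, abs_mul, abs_of_pos (h.wt_pos x)]
  have eY2 : (fun x => (T x - x + x₀) ^ 2 * wt f x) = fun x =>
      (T x - x) ^ 2 * wt f x + 2 * x₀ * ((T x - x) * wt f x) + x₀ ^ 2 * wt f x := by
    ext x; ring
  have iY2 : Integrable fun x => (T x - x + x₀) ^ 2 * wt f x := by
    rw [eY2]
    exact (iP.add (i1.const_mul _)).add (h.integrable_wt.const_mul _)
  have vY2 : ∫ x, (T x - x + x₀) ^ 2 * wt f x = P + x₀ ^ 2 := by
    rw [eY2, integral_add (f := fun x => (T x - x) ^ 2 * wt f x + 2 * x₀ * ((T x - x) * wt f x))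
      (iP.add (i1.const_mul _)) (h.integrable_wt.const_mul _), integral_add iP (i1.const_mul _),
      integral_const_mul, integral_const_mul, integral_displacement h hT, h.integral_wt]
    ring
  set A := ∫ x, |T x - x + x₀| * wt f x with hA
  have hx₀ : |x₀| ≤ A := by
    have e1 : x₀ = ∫ x, (T x - x + x₀) * wt f x := by
      simp only [add_mul]
      rw [integral_add i1 (h.integrable_wt.const_mul _), integral_displacement h hT,
        integral_const_mul, h.integral_wt]
      ring
    rw [e1]
    refine abs_integral_le_integral_abs.trans_eq ?_
    refine integral_congr_ae (Eventually.of_forall fun x => ?_)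
    simp only [abs_mul, abs_of_pos (h.wt_pos x)]
  set E := {y : ℝ | 1 / 2 < κ * Real.exp (y ^ 2 / 4)} with hE
  have hEm : MeasurableSet E := measurableSet_lt measurable_const (by fun_prop)
  let v : ℝ → ℝ := E.indicator 1
  have hv2 : ∀ y, v y ^ 2 = v y := fun y => by by_cases hy : y ∈ E <;> simp [v, hy]
  have hv0 : ∀ y, 0 ≤ v y := fun y => indicator_nonneg (fun _ _ => zero_le_one) y
  have hv1 : ∀ y, v y ≤ 1 := fun y => indicator_le_self' (fun _ _ => zero_le_one) y
  have iv : Integrable v γ := (integrable_const (1 : ℝ)).indicator hEm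
  have iv' := (hT.integrable_comp_iff h).2 iv
  have vv : ∫ x, v (T x) * wt f x ≤ 8 * κ ^ 2 := by
    rw [hT.integral_comp h v, integral_indicator_one hEm]
    exact measureReal_tail_le hκ0
  have hvm : Measurable v := measurable_one.indicator hEm
  have hYc : Continuous fun x => T x - x + x₀ :=
    (hT.continuous.sub continuous_id).add continuous_const
  have iYv : Integrable fun x => |(T x - x + x₀) * v (T x)| * wt f x := by
    refine iY.mono' ((hYc.measurable.mul
      (hvm.comp hT.continuous.measurable)).norm.mul
        h.continuous_wt.measurable).aestronglyMeasurable (Eventually.of_forall fun x => ?_)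
    rw [Real.norm_of_nonneg (mul_nonneg (abs_nonneg _) (hw x)), abs_mul, abs_of_nonneg (hv0 (T x))]
    exact mul_le_mul_of_nonneg_right
      (mul_le_of_le_one_right (abs_nonneg _) (hv1 _)) (hw x)
  -- The factor 3 bounds √8, from the mass 8κ² of the exceptional set.
  have tail : ∫ x, |(T x - x + x₀) * v (T x)| * wt f x ≤ 3 * κ * (√P + |x₀|) := by
    have cs := sq_integral_abs_mul_le (u := fun x => T x - x + x₀) (v := fun x => v (T x)) hw iY2
      (by simpa only [hv2] using iv') iYv
    simp only [hv2] at cs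
    rw [vY2] at cs
    refine (abs_le_of_sq_le_sq' (cs.trans ?_) (by positivity)).2
    have h1 : (P + x₀ ^ 2) * ∫ x, v (T x) * wt f x ≤ (P + x₀ ^ 2) * (8 * κ ^ 2) :=
      mul_le_mul_of_nonneg_left vv (by positivity)
    have h2 : P + x₀ ^ 2 ≤ (√P + |x₀|) ^ 2 := by
      nlinarith [Real.sq_sqrt hP0, sq_abs x₀, Real.sqrt_nonneg P, abs_nonneg x₀,
        mul_nonneg (Real.sqrt_nonneg P) (abs_nonneg x₀)]
    have h3 := mul_le_mul_of_nonneg_right h2 (sq_nonneg κ)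
    have h4 : 0 ≤ (√P + |x₀|) ^ 2 * κ ^ 2 := by positivity
    nlinarith
  have imain := (hT.integrable_comp_iff h).2 integrable_abs_mul_exp_γ
  have main : A ≤ 2 * κ * c + 3 * κ * (√P + |x₀|) := by
    have hpt : ∀ x, |T x - x + x₀| * wt f x ≤
        2 * κ * (|T x| * Real.exp (T x ^ 2 / 4) * wt f x) +
          |(T x - x + x₀) * v (T x)| * wt f x := fun x => by
      by_cases hx : T x ∈ E
      · have : v (T x) = 1 := by simp [v, hx]
        rw [this, mul_one]
        have := h.wt_pos x
        have : 0 ≤ 2 * κ * (|T x| * Real.exp (T x ^ 2 / 4) * wt f x) := by positivity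
        linarith
      · have : v (T x) = 0 := by simp [v, hx]
        rw [this, mul_zero, abs_zero, zero_mul, add_zero]
        have := abs_displacement_le h hT he0.le he h0 (not_lt.1 hx)
        have := mul_le_mul_of_nonneg_right this (hw x)
        linarith
    have := integral_mono iY ((imain.const_mul _).add iYv) hpt
    rw [integral_add' (imain.const_mul _) iYv, integral_const_mul,
      hT.integral_comp h fun y => |y| * Real.exp (y ^ 2 / 4)] at this
    linarith
  have last : ∫ x, |T x - x| * wt f x ≤ A + |x₀| := by
    have hpt : ∀ x, |T x - x| * wt f x ≤ |T x - x + x₀| * wt f x + |x₀| * wt f x := fun x => by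
      rw [← add_mul]
      refine mul_le_mul_of_nonneg_right ?_ (hw x)
      have := abs_sub (T x - x + x₀) x₀
      rwa [add_sub_cancel_right] at this
    have := integral_mono iabs (iY.add (h.integrable_wt.const_mul _)) hpt
    rw [integral_add' iY (h.integrable_wt.const_mul _), integral_const_mul, h.integral_wt,
      mul_one] at this
    exact this
  have hA0 : 0 ≤ A := (abs_nonneg _).trans hx₀
  -- Here |x₀| ≤ A and κ ≤ 1/6; hence A ≤ 4κc + 6κ√P, and A + |x₀| ≤ 2A.
  have h5 : 3 * κ * |x₀| ≤ 1 / 2 * A := by nlinarith [abs_nonneg x₀]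
  nlinarith [Real.sqrt_nonneg P]

end displacement

/-! ### Stability for positive densities -/

/-- The constant in the stability estimate, in terms of a bound `m` on the second moment. -/
noncomputable def stabConst (m : ℝ) : ℝ :=
  1 + √(2 * Real.pi) * (8 * (∫ y, |y| * Real.exp (y ^ 2 / 4) ∂γ) + 12 * √(2 * (1 + m)))

theorem stabConst_pos (m : ℝ) : 0 < stabConst m := by
  have : 0 ≤ ∫ y, |y| * Real.exp (y ^ 2 / 4) ∂γ := integral_nonneg fun y => by positivity
  unfold stabConst
  positivity

namespace IsPosDensity

variable {f f' : ℝ → ℝ}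

theorem integrable_mul_log (h : IsPosDensity f f') :
    Integrable (fun x => f x * Real.log (f x)) γ := by
  obtain ⟨T, hT⟩ := h.exists_isTransport
  exact integrable_entropy h hT

theorem integral_mul_log_le (h : IsPosDensity f f') :
    ∫ x, f x * Real.log (f x) ∂γ ≤ 1 / 2 * ∫ x, f' x ^ 2 / f x ∂γ := by
  obtain ⟨T, hT⟩ := h.exists_isTransport
  have h1 := half_integral_disc_sq_le h hT
  have h2 : 0 ≤ ∫ x, disc f f' T x ^ 2 * wt f x :=
    integral_nonneg fun x => mul_nonneg (sq_nonneg _) (h.wt_pos x).le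
  linarith

/-- The score is the discrepancy minus the displacement, and both are square integrable with bounds
in terms of the deficit and the second moment. No prior bound on the Fisher information is thus
needed; this later bounds the Dirichlet energy of the amplitude. -/
theorem integral_mul_log_le_deficit (h : IsPosDensity f f') {d m : ℝ}
    (hd : 1 / 2 * (∫ x, f' x ^ 2 / f x ∂γ) - ∫ x, f x * Real.log (f x) ∂γ ≤ d)
    (hm : ∫ x, x ^ 2 * f x ∂γ ≤ m) :
    ∫ x, f x * Real.log (f x) ∂γ ≤ 2 * d + 2 * (1 + m) := by
  obtain ⟨T, hT⟩ := h.exists_isTransport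
  have h1 := half_integral_disc_sq_le h hT
  have h2 := integral_displacement_sq_le h hT
  have h3 : ∫ x, (f' x / f x) ^ 2 * wt f x ≤ ∫ x, (2 * (disc f f' T x ^ 2 * wt f x) +
      2 * ((T x - x) ^ 2 * wt f x)) := by
    refine integral_mono h.integrable_score_sq (((integrable_disc_sq h hT).const_mul 2).add
      ((integrable_displacement_sq h hT).const_mul 2)) fun x => ?_
    simp only [disc]
    nlinarith [mul_nonneg (sq_nonneg (f' x / f x + 2 * (T x - x))) (h.wt_pos x).le]
  rw [integral_add ((integrable_disc_sq h hT).const_mul 2)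
    ((integrable_displacement_sq h hT).const_mul 2), integral_const_mul, integral_const_mul,
    h.integral_score_sq] at h3
  have h4 : 0 ≤ ∫ x, disc f f' T x ^ 2 * wt f x :=
    integral_nonneg fun x => mul_nonneg (sq_nonneg _) (h.wt_pos x).le
  linarith

/-- Write f' as the discrepancy minus the displacement, times f: Cauchy-Schwarz bounds the first
part by e and `integral_abs_displacement_le` the second by a multiple of e. -/
theorem integral_abs_deriv_le (h : IsPosDensity f f') {e m : ℝ} (he : 0 < e)
    (hd : 1 / 2 * (∫ x, f' x ^ 2 / f x ∂γ) - ∫ x, f x * Real.log (f x) ∂γ ≤ e ^ 2 / 2)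
    (hm : ∫ x, x ^ 2 * f x ∂γ ≤ m) :
    ∫ x, |f' x| ∂γ ≤ stabConst m * e := by
  obtain ⟨T, hT⟩ := h.exists_isTransport
  have h1 : ∫ x, disc f f' T x ^ 2 * wt f x ≤ e ^ 2 := by
    linarith [half_integral_disc_sq_le h hT]
  have h2 := integral_abs_disc_le h hT he.le h1
  have h3 := integral_abs_displacement_le h hT he h1
  have h4 : √(∫ x, (T x - x) ^ 2 * wt f x) ≤ √(2 * (1 + m)) :=
    Real.sqrt_le_sqrt ((integral_displacement_sq_le h hT).trans (by linarith))
  have iabs : Integrable fun x => |T x - x| * wt f x := by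
    refine (integrable_displacement h hT).abs.congr (Eventually.of_forall fun x => ?_)
    simp only [abs_mul, abs_of_pos (h.wt_pos x)]
  have id := integrable_abs_disc h hT
  have h5 : ∫ x, |f' x| ∂γ ≤
      ∫ x, (|disc f f' T x| * wt f x + |T x - x| * wt f x) := by
    rw [integral_γ]
    refine integral_mono_of_nonneg (Eventually.of_forall fun x =>
      mul_nonneg (gdens_pos x).le (abs_nonneg _)) (id.add iabs) (Eventually.of_forall fun x => ?_)
    simp only
    have e1 : gdens x * |f' x| = |f' x / f x| * wt f x := by
      have := h.pos x
      rw [abs_div, abs_of_pos this, wt]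
      field_simp
    have e2 : f' x / f x = disc f f' T x - (T x - x) := by
      simp only [disc]
      ring
    rw [e1, ← add_mul, e2]
    exact mul_le_mul_of_nonneg_right (abs_sub _ _) (h.wt_pos x).le
  rw [integral_add id iabs] at h5
  have h6 : √(2 * Real.pi) * e * (8 * (∫ y, |y| * Real.exp (y ^ 2 / 4) ∂γ) +
      12 * √(∫ x, (T x - x) ^ 2 * wt f x)) ≤ √(2 * Real.pi) * e *
        (8 * (∫ y, |y| * Real.exp (y ^ 2 / 4) ∂γ) + 12 * √(2 * (1 + m))) := by
    gcongr
  rw [stabConst]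
  linarith

end IsPosDensity

/-! ### Densities with zeros: mixing v² with the Gaussian and letting t → 0 -/

/-- `v` is locally absolutely continuous with derivative `w`, both are square integrable with
respect to the Gaussian measure, and `v² dγ` is a centered probability measure whose second moment
is at most `m`. -/
structure IsAmplitude (v w : ℝ → ℝ) (m : ℝ) : Prop where
  prim : IsPrimitive v w
  integrable_sq : Integrable (fun x => v x ^ 2) γ
  integrable_deriv_sq : Integrable (fun x => w x ^ 2) γ
  integral_sq : ∫ x, v x ^ 2 ∂γ = 1
  centered : ∫ x, x * v x ^ 2 ∂γ = 0
  second_moment : Integrable (fun x => x ^ 2 * v x ^ 2) γ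
  second_moment_le : ∫ x, x ^ 2 * v x ^ 2 ∂γ ≤ m
  one_le : 1 ≤ m

namespace IsAmplitude

variable {v w : ℝ → ℝ} {m : ℝ}

theorem isPrimitive_sq (h : IsAmplitude v w m) :
    IsPrimitive (fun x => v x ^ 2) (fun x => 2 * v x * w x) := by
  convert h.prim.mul h.prim using 2 <;> ring

theorem aestronglyMeasurable_deriv (h : IsAmplitude v w m) : AEStronglyMeasurable w γ :=
  AEStronglyMeasurable.mono_ac (gaussianReal_absolutelyContinuous 0 one_ne_zero)
    h.prim.locallyIntegrable.aestronglyMeasurable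

theorem integrable_fisher (h : IsAmplitude v w m) :
    Integrable (fun x => (2 * v x * w x) ^ 2 / v x ^ 2) γ := by
  have hv := h.prim.continuous.aestronglyMeasurable (μ := γ)
  refine (h.integrable_deriv_sq.const_mul 4).mono'
    ((((hv.const_mul 2).mul h.aestronglyMeasurable_deriv).pow 2).div₀ (hv.pow 2))
    (Eventually.of_forall fun x => ?_)
  rw [Real.norm_of_nonneg (by positivity)]
  -- Where v vanishes the quotient is 0 by convention; elsewhere it equals 4w².
  by_cases hx : v x = 0
  · simp only [hx]
    norm_num
    positivity
  · refine le_of_eq ?_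
    field_simp
    ring

theorem integral_fisher_le (h : IsAmplitude v w m) :
    ∫ x, (2 * v x * w x) ^ 2 / v x ^ 2 ∂γ ≤ 4 * ∫ x, w x ^ 2 ∂γ := by
  rw [← integral_const_mul]
  refine integral_mono h.integrable_fisher (h.integrable_deriv_sq.const_mul 4) fun x => ?_
  by_cases hx : v x = 0
  · simp only [hx]
    norm_num
    positivity
  · refine le_of_eq ?_
    field_simp
    ring

theorem integrable_deriv (h : IsAmplitude v w m) : Integrable (fun x => 2 * v x * w x) γ := by
  refine (h.integrable_sq.add h.integrable_deriv_sq).mono'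
    (((h.prim.continuous.aestronglyMeasurable (μ := γ)).const_mul 2).mul
      h.aestronglyMeasurable_deriv) (Eventually.of_forall fun x => ?_)
  rw [Real.norm_eq_abs, Pi.add_apply]
  exact abs_le.2 ⟨by nlinarith [sq_nonneg (v x + w x)], by nlinarith [sq_nonneg (v x - w x)]⟩

theorem integrable_mul_sq (h : IsAmplitude v w m) : Integrable (fun x => x * v x ^ 2) γ := by
  refine (h.integrable_sq.add h.second_moment).mono'
    (continuous_id.mul (h.prim.continuous.pow 2)).aestronglyMeasurable
    (Eventually.of_forall fun x => ?_)
  rw [Real.norm_eq_abs, abs_mul, abs_of_nonneg (sq_nonneg (v x)), Pi.add_apply, ← sq_abs x]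
  nlinarith [mul_nonneg (sq_nonneg (|x| - 1)) (sq_nonneg (v x)),
    mul_nonneg (abs_nonneg x) (sq_nonneg (v x))]

/-- Mixing with the Gaussian produces a positive density. -/
theorem isPosDensity_mix (h : IsAmplitude v w m) {t : ℝ} (ht : 0 < t) :
    IsPosDensity (fun x => (1 + t)⁻¹ * (v x ^ 2 + t)) (fun x => (1 + t)⁻¹ * (2 * v x * w x)) where
  prim := by
    have := (h.isPrimitive_sq.add (IsPrimitive.const t)).const_mul (1 + t)⁻¹
    simpa only [add_zero] using this
  pos x := by positivity
  integrable := (h.integrable_sq.add (integrable_const t)).const_mul _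
  integral_eq_one := by
    rw [integral_const_mul, integral_add h.integrable_sq (integrable_const t), h.integral_sq]
    simp only [integral_const, probReal_univ, one_smul]
    exact inv_mul_cancel₀ (by positivity)
  centered := by
    have e : (fun x => x * ((1 + t)⁻¹ * (v x ^ 2 + t))) =
        fun x => (1 + t)⁻¹ * (x * v x ^ 2 + x * t) := by
      ext x; ring
    rw [e, integral_const_mul, integral_add h.integrable_mul_sq (integrable_id_γ.mul_const t),
      h.centered, integral_mul_const, integral_id_γ]
    simp
  second_moment := by
    have e : (fun x => x ^ 2 * ((1 + t)⁻¹ * (v x ^ 2 + t))) =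
        fun x => (1 + t)⁻¹ * (x ^ 2 * v x ^ 2 + x ^ 2 * t) := by
      ext x; ring
    rw [e]
    exact (h.second_moment.add (integrable_sq_γ.mul_const t)).const_mul _
  fisher := by
    have hv := h.prim.continuous.aestronglyMeasurable (μ := γ)
    refine (h.integrable_deriv_sq.const_mul 4).mono'
      (((((hv.const_mul 2).mul h.aestronglyMeasurable_deriv).const_mul _).pow 2).div₀
        (((hv.pow 2).add_const t).const_mul _)) (Eventually.of_forall fun x => ?_)
    rw [Real.norm_of_nonneg (by positivity), div_le_iff₀ (by positivity), mul_pow, sq (1 + t)⁻¹]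
    have h1 : (1 + t)⁻¹ ≤ 1 := inv_le_one_of_one_le₀ (by linarith)
    have h2 : 0 < (1 + t)⁻¹ := by positivity
    have h3 : (2 * v x * w x) ^ 2 ≤ 4 * w x ^ 2 * (v x ^ 2 + t) := by
      nlinarith [mul_nonneg (sq_nonneg (w x)) ht.le]
    calc (1 + t)⁻¹ * (1 + t)⁻¹ * (2 * v x * w x) ^ 2
        ≤ 1 * (1 + t)⁻¹ * (4 * w x ^ 2 * (v x ^ 2 + t)) := by gcongr
      _ = _ := by ring

/-- The mixture averages the second moment of v² with that of γ, which is 1; this is why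
`IsAmplitude` requires 1 ≤ m. -/
theorem second_moment_mix_le (h : IsAmplitude v w m) {t : ℝ} (ht : 0 < t) :
    ∫ x, x ^ 2 * ((1 + t)⁻¹ * (v x ^ 2 + t)) ∂γ ≤ m := by
  have e : (fun x => x ^ 2 * ((1 + t)⁻¹ * (v x ^ 2 + t))) =
      fun x => (1 + t)⁻¹ * (x ^ 2 * v x ^ 2 + x ^ 2 * t) := by
    ext x; ring
  rw [e, integral_const_mul, integral_add h.second_moment (integrable_sq_γ.mul_const t),
    integral_mul_const, integral_sq_γ, inv_mul_le_iff₀ (by positivity)]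
  nlinarith [h.second_moment_le, h.one_le]

theorem integral_fisher_mix_le (h : IsAmplitude v w m) {t : ℝ} (ht : 0 < t) :
    ∫ x, ((1 + t)⁻¹ * (2 * v x * w x)) ^ 2 / ((1 + t)⁻¹ * (v x ^ 2 + t)) ∂γ ≤
      (1 + t)⁻¹ * ∫ x, (2 * v x * w x) ^ 2 / v x ^ 2 ∂γ := by
  rw [← integral_const_mul]
  refine integral_mono (h.isPosDensity_mix ht).fisher (h.integrable_fisher.const_mul _)
    fun x => ?_
  simp only
  by_cases hx : v x = 0
  · simp [hx]
  · have hv : 0 < v x ^ 2 := by positivity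
    have e : ((1 + t)⁻¹ * (2 * v x * w x)) ^ 2 / ((1 + t)⁻¹ * (v x ^ 2 + t)) =
        (1 + t)⁻¹ * ((2 * v x * w x) ^ 2 / (v x ^ 2 + t)) := by
      field_simp
    rw [e]
    gcongr
    linarith

/-- Add a log a ≤ a log (a + t) and t log t ≤ t log (a + t), then extract the normalization 1 + t
from the logarithm. -/
theorem mul_log_le_mix {a t : ℝ} (ha : 0 ≤ a) (ht : 0 < t) :
    a * Real.log a ≤ (1 + t) * (((1 + t)⁻¹ * (a + t)) * Real.log ((1 + t)⁻¹ * (a + t))) +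
      (a + t) * Real.log (1 + t) - t * Real.log t := by
  have h1 : Real.log ((1 + t)⁻¹ * (a + t)) = Real.log (a + t) - Real.log (1 + t) := by
    rw [Real.log_mul (by positivity) (by positivity), Real.log_inv]
    ring
  have h2 : a * Real.log a ≤ a * Real.log (a + t) := by
    rcases ha.eq_or_lt with rfl | ha
    · simp
    · exact mul_le_mul_of_nonneg_left (Real.log_le_log ha (by linarith)) ha.le
  have h3 : t * Real.log t ≤ t * Real.log (a + t) :=
    mul_le_mul_of_nonneg_left (Real.log_le_log ht (by linarith)) ht.le
  have h4 : (1 + t) * (((1 + t)⁻¹ * (a + t)) * Real.log ((1 + t)⁻¹ * (a + t))) =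
      (a + t) * Real.log ((1 + t)⁻¹ * (a + t)) := by
    field_simp
  rw [h4, h1]
  linarith

theorem integrable_mix_bound (h : IsAmplitude v w m) {t : ℝ} (ht : 0 < t) :
    Integrable (fun x => (1 + t) * (((1 + t)⁻¹ * (v x ^ 2 + t)) *
      Real.log ((1 + t)⁻¹ * (v x ^ 2 + t))) + (v x ^ 2 + t) * Real.log (1 + t) -
        t * Real.log t) γ :=
  (((h.isPosDensity_mix ht).integrable_mul_log.const_mul _).add
    ((h.integrable_sq.add (integrable_const t)).mul_const _)).sub (integrable_const _)

theorem integrable_mul_log (h : IsAmplitude v w m) :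
    Integrable (fun x => v x ^ 2 * Real.log (v x ^ 2)) γ := by
  refine ((h.integrable_mix_bound one_pos).norm.add (integrable_const (1 : ℝ))).mono'
    (Real.continuous_mul_log.comp (h.prim.continuous.pow 2)).aestronglyMeasurable
    (Eventually.of_forall fun x => ?_)
  -- The integrand lies between -1 and the integrable bound furnished by the mixture with t = 1.
  have h1 := mul_log_le_mix (sq_nonneg (v x)) one_pos
  have h2 : -1 ≤ v x ^ 2 * Real.log (v x ^ 2) := by
    rcases (sq_nonneg (v x)).eq_or_lt with h0 | h0
    · rw [← h0]
      norm_num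
    · have h3 := mul_le_mul_of_nonneg_left (Real.one_sub_inv_le_log_of_pos h0) h0.le
      rw [mul_sub, mul_one, mul_inv_cancel₀ h0.ne'] at h3
      linarith
  rw [Real.norm_eq_abs, Pi.add_apply]
  refine abs_le.2 ⟨?_, ?_⟩
  · linarith [norm_nonneg ((1 + 1) * (((1 + 1)⁻¹ * (v x ^ 2 + 1)) *
      Real.log ((1 + 1)⁻¹ * (v x ^ 2 + 1))) + (v x ^ 2 + 1) * Real.log (1 + 1) -
        1 * Real.log 1)]
  · exact (h1.trans (Real.le_norm_self _)).trans (by linarith)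

theorem integral_mul_log_le_mix (h : IsAmplitude v w m) {t : ℝ} (ht : 0 < t) :
    ∫ x, v x ^ 2 * Real.log (v x ^ 2) ∂γ ≤ (1 + t) * (∫ x, ((1 + t)⁻¹ * (v x ^ 2 + t)) *
      Real.log ((1 + t)⁻¹ * (v x ^ 2 + t)) ∂γ) + (1 + t) * Real.log (1 + t) -
        t * Real.log t := by
  have h1 := integral_mono h.integrable_mul_log (h.integrable_mix_bound ht)
    fun x => mul_log_le_mix (sq_nonneg (v x)) ht
  have i1 := (h.isPosDensity_mix ht).integrable_mul_log.const_mul (1 + t)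
  have i2 := (h.integrable_sq.add (integrable_const t)).mul_const (Real.log (1 + t))
  have e1 := integral_sub (i1.add i2) (integrable_const (t * Real.log t))
  have e2 := integral_add i1 i2
  have e3 := integral_add h.integrable_sq (integrable_const (μ := γ) t)
  simp only [Pi.add_apply] at e1 e2
  rw [e1, e2, integral_const_mul, integral_mul_const, e3, h.integral_sq] at h1
  simpa using h1

/-- The logarithmic Sobolev deficit of `v²`. -/
noncomputable def deficitSq (v w : ℝ → ℝ) : ℝ :=
  1 / 2 * (∫ x, (2 * v x * w x) ^ 2 / v x ^ 2 ∂γ) - ∫ x, v x ^ 2 * Real.log (v x ^ 2) ∂γ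

/-- An upper bound for the deficit of the mixture, which converges to `d` as `t → 0`. -/
noncomputable def mixBound (d t : ℝ) : ℝ := (1 + t)⁻¹ * (d - t * Real.log t) + Real.log (1 + t)

theorem tendsto_mixBound (d : ℝ) : Tendsto (mixBound d) (𝓝[>] 0) (𝓝 d) := by
  have h : ContinuousAt (mixBound d) 0 := by
    unfold mixBound
    refine ContinuousAt.add (ContinuousAt.mul (ContinuousAt.inv₀ (by fun_prop) (by norm_num))
      (continuousAt_const.sub Real.continuous_mul_log.continuousAt))
      (ContinuousAt.log (by fun_prop) (by norm_num))
  have h0 : mixBound d 0 = d := by simp [mixBound]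
  have h1 := h.tendsto
  rw [h0] at h1
  exact h1.mono_left nhdsWithin_le_nhds

theorem deficit_mix_le (h : IsAmplitude v w m) {t : ℝ} (ht : 0 < t) :
    1 / 2 * (∫ x, ((1 + t)⁻¹ * (2 * v x * w x)) ^ 2 / ((1 + t)⁻¹ * (v x ^ 2 + t)) ∂γ) -
      ∫ x, ((1 + t)⁻¹ * (v x ^ 2 + t)) * Real.log ((1 + t)⁻¹ * (v x ^ 2 + t)) ∂γ ≤
        mixBound (deficitSq v w) t := by
  have h1 := h.integral_fisher_mix_le ht
  have h2 := mul_le_mul_of_nonneg_left (h.integral_mul_log_le_mix ht)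
    (by positivity : (0 : ℝ) ≤ (1 + t)⁻¹)
  rw [mul_sub, mul_add, inv_mul_cancel_left₀ (by positivity),
    inv_mul_cancel_left₀ (by positivity)] at h2
  rw [mixBound, deficitSq, mul_sub, mul_sub]
  linarith

theorem deficitSq_nonneg (h : IsAmplitude v w m) : 0 ≤ deficitSq v w := by
  refine ge_of_tendsto (tendsto_mixBound _) (eventually_nhdsWithin_of_forall fun t ht => ?_)
  linarith [h.deficit_mix_le (mem_Ioi.1 ht), (h.isPosDensity_mix (mem_Ioi.1 ht)).integral_mul_log_le]

theorem integral_mul_log_le (h : IsAmplitude v w m) :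
    ∫ x, v x ^ 2 * Real.log (v x ^ 2) ∂γ ≤ 2 * deficitSq v w + 2 * (1 + m) := by
  have h1 : ContinuousAt (fun t : ℝ => 1 + t) 0 := by fun_prop
  have h2 : ContinuousAt (fun t : ℝ => (1 + t) * Real.log (1 + t) - t * Real.log t) 0 :=
    (h1.mul (h1.log (by norm_num))).sub Real.continuous_mul_log.continuousAt
  have l1 := h1.tendsto.mono_left (nhdsWithin_le_nhds (s := Ioi 0))
  have l2 := h2.tendsto.mono_left (nhdsWithin_le_nhds (s := Ioi 0))
  have lim := (l1.mul (((tendsto_mixBound (deficitSq v w)).const_mul 2).add_const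
    (2 * (1 + m)))).add l2
  simp only [add_zero, Real.log_one, mul_zero, one_mul, zero_mul, sub_zero] at lim
  refine ge_of_tendsto lim (eventually_nhdsWithin_of_forall fun t ht => ?_)
  have ht : 0 < t := ht
  have h3 := (h.isPosDensity_mix ht).integral_mul_log_le_deficit (h.deficit_mix_le ht)
    (h.second_moment_mix_le ht)
  have h4 := mul_le_mul_of_nonneg_left h3 (by positivity : 0 ≤ 1 + t)
  linarith [h.integral_mul_log_le_mix ht]

/-- The estimate for positive densities needs a strictly positive e, so e is taken above √(2δ). For
small t the mixture has deficit below e²/2; first t → 0, then e decreases to √(2δ), which also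
covers δ = 0. -/
theorem integral_abs_deriv_le (h : IsAmplitude v w m) :
    ∫ x, |2 * v x * w x| ∂γ ≤ stabConst m * √(2 * deficitSq v w) := by
  have hC := stabConst_pos m
  rw [← div_le_iff₀' hC]
  refine le_of_forall_gt_imp_ge_of_dense fun e he => ?_
  rw [div_le_iff₀' hC]
  have he0 : 0 < e := (Real.sqrt_nonneg _).trans_lt he
  have hlt : deficitSq v w < e ^ 2 / 2 := by
    have := (Real.sqrt_lt' he0).1 he
    linarith
  have h1 : ContinuousAt (fun t : ℝ => (1 + t) * (stabConst m * e)) 0 := by fun_prop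
  have l1 := h1.tendsto.mono_left (nhdsWithin_le_nhds (s := Ioi 0))
  simp only [add_zero, one_mul] at l1
  refine ge_of_tendsto l1 ?_
  filter_upwards [(tendsto_mixBound _).eventually (gt_mem_nhds hlt), self_mem_nhdsWithin]
    with t ht1 ht
  have ht : 0 < t := ht
  have h2 := (h.isPosDensity_mix ht).integral_abs_deriv_le he0
    ((h.deficit_mix_le ht).trans ht1.le) (h.second_moment_mix_le ht)
  simp only [abs_mul (1 + t)⁻¹] at h2
  rw [integral_const_mul, abs_of_pos (by positivity), inv_mul_le_iff₀ (by positivity)] at h2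
  exact h2

theorem integral_abs_sq_sub_one_le (h : IsAmplitude v w m) :
    ∫ x, |v x ^ 2 - 1| ∂γ ≤ 4 * √(2 * Real.pi) * ∫ x, |2 * v x * w x| ∂γ := by
  have := integral_abs_sub_mean_le h.isPrimitive_sq h.integrable_sq h.integrable_deriv
  rwa [h.integral_sq] at this

/-- Where `v²` is not small, `w` is controlled by the derivative of `v²`; the remaining set has
small measure. -/
theorem integral_abs_amplitude_deriv_le (h : IsAmplitude v w m) :
    ∫ x, |w x| ∂γ ≤ ∫ x, |2 * v x * w x| ∂γ +
      √(4 / 3 * ∫ x, |v x ^ 2 - 1| ∂γ) * √(∫ x, w x ^ 2 ∂γ) := by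
  set S := {x | v x ^ 2 < 1 / 4} with hS
  have hSm : MeasurableSet S :=
    (isOpen_lt (h.prim.continuous.pow 2) continuous_const).measurableSet
  let k : ℝ → ℝ := S.indicator 1
  have hk2 : ∀ y, k y ^ 2 = k y := fun y => by by_cases hy : y ∈ S <;> simp [k, hy]
  have ik : Integrable k γ := (integrable_const (1 : ℝ)).indicator hSm
  have hi1 : Integrable (fun x => |v x ^ 2 - 1|) γ :=
    (h.integrable_sq.sub (integrable_const _)).abs
  -- On `S` one has |v² - 1| > 3/4, so Markov's inequality gives the factor 4/3.
  have vk : ∫ x, k x ∂γ ≤ 4 / 3 * ∫ x, |v x ^ 2 - 1| ∂γ := by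
    rw [← integral_const_mul]
    refine integral_mono ik (hi1.const_mul _) fun x => ?_
    by_cases hx : x ∈ S
    · have : v x ^ 2 < 1 / 4 := hx
      simp only [k, indicator_of_mem hx, Pi.one_apply]
      rw [abs_of_neg (by linarith)]
      linarith
    · simp only [k, indicator_of_notMem hx]
      positivity
  have iwk : Integrable (fun x => |w x * k x|) γ := by
    refine (((integrable_const (1 : ℝ)).add h.integrable_deriv_sq)).mono'
      (h.aestronglyMeasurable_deriv.mul ik.aestronglyMeasurable).norm
      (Eventually.of_forall fun x => ?_)
    have h1 : |k x| ≤ 1 := by by_cases hx : x ∈ S <;> simp [k, hx]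
    have h2 := mul_le_mul_of_nonneg_left h1 (abs_nonneg (w x))
    rw [Real.norm_eq_abs, abs_abs, abs_mul, Pi.add_apply, ← sq_abs (w x)]
    nlinarith [sq_nonneg (|w x| - 1), abs_nonneg (w x)]
  have cs := sq_integral_abs_mul_le (μ := γ) (u := w) (v := k) (w := fun _ => 1)
    (fun _ => zero_le_one) (by simpa using h.integrable_deriv_sq)
    (by simpa only [hk2, mul_one] using ik) (by simpa using iwk)
  simp only [mul_one, hk2] at cs
  have hw0 : 0 ≤ ∫ x, w x ^ 2 ∂γ := integral_nonneg fun x => sq_nonneg _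
  have h1 : ∫ x, |w x * k x| ∂γ ≤
      √(4 / 3 * ∫ x, |v x ^ 2 - 1| ∂γ) * √(∫ x, w x ^ 2 ∂γ) := by
    rw [← Real.sqrt_mul' _ hw0]
    refine Real.le_sqrt_of_sq_le (cs.trans ?_)
    rw [mul_comm]
    exact mul_le_mul_of_nonneg_right vk hw0
  refine le_trans ?_ (add_le_add_right h1 _)
  rw [← integral_add h.integrable_deriv.abs iwk]
  refine integral_mono_of_nonneg (Eventually.of_forall fun x => abs_nonneg _)
    (h.integrable_deriv.abs.add iwk) (Eventually.of_forall fun x => ?_)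
  simp only [abs_mul, Nat.abs_ofNat]
  by_cases hx : x ∈ S
  · simp only [k, indicator_of_mem hx, Pi.one_apply, abs_one, mul_one]
    exact le_add_of_nonneg_left (by positivity)
  · have h2 : 1 / 4 ≤ v x ^ 2 := not_lt.1 hx
    have h3 : 1 / 2 ≤ |v x| := by
      refine abs_le_of_sq_le_sq' (a := 1 / 2) ?_ (abs_nonneg _) |>.2
      rw [sq_abs]
      linarith
    simp only [k, indicator_of_notMem hx, abs_zero, mul_zero, add_zero]
    nlinarith [abs_nonneg (w x)]

end IsAmplitude

/-! ### Stability estimates with explicit powers of the deficit -/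

theorem HasWeakDeriv.congr {f₁ f₂ g₁ g₂ : ℝ → ℝ} (h : HasWeakDeriv f₁ g₁)
    (hf : f₁ =ᵐ[volume] f₂) (hg : g₁ =ᵐ[volume] g₂) : HasWeakDeriv f₂ g₂ := by
  refine ⟨h.1.congr hf, h.2.1.congr hg, fun φ hφ hc => ?_⟩
  have h1 := h.2.2 φ hφ hc
  rw [integral_congr_ae (f := fun x => f₁ x * deriv φ x) (g := fun x => f₂ x * deriv φ x)
      (by filter_upwards [hf] with x hx; rw [hx]),
    integral_congr_ae (f := fun x => g₁ x * φ x) (g := fun x => g₂ x * φ x)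
      (by filter_upwards [hg] with x hx; rw [hx])] at h1
  exact h1

theorem HasWeakDeriv.weakDeriv_ae_eq {f g : ℝ → ℝ} (h : HasWeakDeriv f g) :
    weakDeriv f =ᵐ[volume] g :=
  (hasWeakDeriv_weakDeriv ⟨g, h⟩).ae_eq h

theorem sqrt_two_mul_le {d : ℝ} (hd : 0 ≤ d) : √(2 * d) ≤ 2 * (d ^ (1 / 4 : ℝ)) ^ 2 := by
  have e : d = ((d ^ (1 / 4 : ℝ)) ^ 2) ^ 2 := by
    rw [← pow_mul, ← Real.rpow_natCast, ← Real.rpow_mul hd]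
    norm_num
  refine Real.sqrt_le_iff.2 ⟨by positivity, ?_⟩
  rw [mul_pow, ← e]
  linarith

namespace IsAmplitude

variable {v w : ℝ → ℝ} {m : ℝ}

/-- The stability estimate for `v² dγ` in `W^{1,1}`. -/
theorem w11_bound (h : IsAmplitude v w m) :
    ∫ x, |v x ^ 2 - 1| ∂γ + ∫ x, |2 * v x * w x| ∂γ ≤
      (4 * √(2 * Real.pi) + 1) * stabConst m * 2 *
        (deficitSq v w ^ (1 / 4 : ℝ) + deficitSq v w ^ (3 / 4 : ℝ)) := by
  have hd := h.deficitSq_nonneg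
  set q := deficitSq v w ^ (1 / 4 : ℝ) with hq
  have hq0 : 0 ≤ q := by positivity
  have e : deficitSq v w ^ (3 / 4 : ℝ) = q ^ 3 := by
    rw [hq, ← Real.rpow_natCast, ← Real.rpow_mul hd]
    norm_num
  have hC := stabConst_pos m
  have h1 := h.integral_abs_deriv_le.trans
    (mul_le_mul_of_nonneg_left (sqrt_two_mul_le hd) hC.le)
  have h2 := h.integral_abs_sq_sub_one_le
  have hs : 0 ≤ √(2 * Real.pi) := Real.sqrt_nonneg _
  rw [e]
  calc ∫ x, |v x ^ 2 - 1| ∂γ + ∫ x, |2 * v x * w x| ∂γ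
      ≤ (4 * √(2 * Real.pi) + 1) * ∫ x, |2 * v x * w x| ∂γ := by linarith
    _ ≤ (4 * √(2 * Real.pi) + 1) * (stabConst m * (2 * (q + q ^ 3))) := by
        gcongr
        refine h1.trans ?_
        gcongr
        -- From q (q - 1)² ≥ 0 follows q² ≤ q + q³.
        nlinarith [mul_nonneg hq0 (sq_nonneg (q - 1))]
    _ = _ := by ring

/-- The constant in the stability estimate for the amplitude. -/
noncomputable def amplitudeConst (m : ℝ) : ℝ :=
  (4 * √(2 * Real.pi) + 2 * √(2 * Real.pi)) * stabConst m * 2 +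
    √(2 * Real.pi) * √(16 / 3 * √(2 * Real.pi) * stabConst m * 2) * (√2 + √(1 + m))

theorem amplitudeConst_pos (hm : 1 ≤ m) : 0 < amplitudeConst m := by
  have := stabConst_pos m
  unfold amplitudeConst
  positivity

/-- The stability estimate for the amplitude `v`, where `d` is the deficit computed with the full
Dirichlet energy. -/
theorem amplitude_bound (h : IsAmplitude v w m) {d : ℝ}
    (hd : d = 2 * (∫ x, w x ^ 2 ∂γ) - ∫ x, v x ^ 2 * Real.log (v x ^ 2) ∂γ) :
    0 ≤ d ∧ ∫ x, |v x ^ 2 - 1| ∂γ + √(2 * Real.pi) * ∫ x, |w x| ∂γ ≤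
      amplitudeConst m * (d ^ (1 / 4 : ℝ) + d) := by
  -- The Fisher integrand of v² is at most 4w², so using the full Dirichlet energy only increases
  -- the deficit.
  have hle : deficitSq v w ≤ d := by
    rw [hd, deficitSq]
    linarith [h.integral_fisher_le]
  have hd0 : 0 ≤ d := h.deficitSq_nonneg.trans hle
  refine ⟨hd0, ?_⟩
  set q := d ^ (1 / 4 : ℝ) with hq
  have hq0 : 0 ≤ q := by positivity
  have e : d = q ^ 4 := by
    rw [hq, ← Real.rpow_natCast, ← Real.rpow_mul hd0]
    norm_num
  have hC := stabConst_pos m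
  have hm := h.one_le
  have hs1 : 1 ≤ √(2 * Real.pi) := by
    rw [Real.one_le_sqrt]
    linarith [Real.pi_gt_three]
  set s := √(2 * Real.pi) with hs
  set C := stabConst m with hCdef
  set L := ∫ x, |2 * v x * w x| ∂γ with hL
  have hL1 : L ≤ C * 2 * q ^ 2 := by
    have h1 := h.integral_abs_deriv_le
    have h2 : √(2 * deficitSq v w) ≤ √(2 * d) := Real.sqrt_le_sqrt (by linarith)
    have h3 := mul_le_mul_of_nonneg_left (h2.trans (sqrt_two_mul_le hd0)) hC.le
    linarith
  have h2 := h.integral_abs_sq_sub_one_le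
  -- Twice the Dirichlet energy is d plus the entropy, and the entropy is at most 2d + 2(1 + m).
  have hW : ∫ x, w x ^ 2 ∂γ ≤ 2 * d + (1 + m) := by
    have := h.integral_mul_log_le
    linarith
  have h4 : √(4 / 3 * ∫ x, |v x ^ 2 - 1| ∂γ) ≤ √(16 / 3 * s * C * 2) * q := by
    refine Real.sqrt_le_iff.2 ⟨by positivity, ?_⟩
    rw [mul_pow, Real.sq_sqrt (by positivity)]
    have := mul_le_mul_of_nonneg_left hL1 (by positivity : 0 ≤ 16 / 3 * s)
    linarith
  have h5 : √(∫ x, w x ^ 2 ∂γ) ≤ √2 * q ^ 2 + √(1 + m) := by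
    refine Real.sqrt_le_iff.2 ⟨by positivity, hW.trans ?_⟩
    have h6 : 0 ≤ √2 * q ^ 2 * √(1 + m) := by positivity
    have h7 : (√2) ^ 2 = 2 := Real.sq_sqrt (by norm_num)
    have h8 : (√(1 + m)) ^ 2 = 1 + m := Real.sq_sqrt (by linarith)
    have h9 : (√2 * q ^ 2 + √(1 + m)) ^ 2 =
        (√2) ^ 2 * q ^ 4 + 2 * (√2 * q ^ 2 * √(1 + m)) + (√(1 + m)) ^ 2 := by ring
    rw [h9, h7, h8, e]
    linarith
  have h10 := h.integral_abs_amplitude_deriv_le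
  set B := √(16 / 3 * s * C * 2) with hB
  have hB0 : 0 ≤ B := Real.sqrt_nonneg _
  have hq3 : q ^ 3 ≤ q + q ^ 4 := by
    rcases le_total q 1 with hq1 | hq1
    · nlinarith [mul_nonneg hq0 (sub_nonneg.2 hq1), pow_nonneg hq0 4, pow_nonneg hq0 2,
        mul_nonneg hq0 (mul_nonneg hq0 (sub_nonneg.2 hq1))]
    · nlinarith [mul_le_mul_of_nonneg_left hq1 (pow_nonneg hq0 3)]
  have hq2 : q ^ 2 ≤ q + q ^ 4 := by
    rcases le_total q 1 with hq1 | hq1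
    · nlinarith [pow_nonneg hq0 4]
    · nlinarith [mul_le_mul_of_nonneg_left hq1 (pow_nonneg hq0 3),
        mul_le_mul_of_nonneg_left hq1 (pow_nonneg hq0 2)]
  have hqq : q ≤ q + q ^ 4 := le_add_of_nonneg_right (by positivity)
  -- The square root of a measure of order q² gives q, and √(∫ w²) is of order q² + 1; their product
  -- q³ + q dictates the powers q = d^{1/4} and q⁴ = d.
  have h11 : ∫ x, |w x| ∂γ ≤ C * 2 * (q + q ^ 4) + B * (√2 + √(1 + m)) * (q + q ^ 4) := by
    refine h10.trans (add_le_add (hL1.trans (by gcongr)) ?_)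
    calc √(4 / 3 * ∫ x, |v x ^ 2 - 1| ∂γ) * √(∫ x, w x ^ 2 ∂γ)
        ≤ (B * q) * (√2 * q ^ 2 + √(1 + m)) := by gcongr
      _ = B * (√2 * q ^ 3 + √(1 + m) * q) := by ring
      _ ≤ B * (√2 * (q + q ^ 4) + √(1 + m) * (q + q ^ 4)) := by gcongr
      _ = _ := by ring
  have h12 : L ≤ C * 2 * (q + q ^ 4) := hL1.trans (by gcongr)
  have e2 : q + d = q + q ^ 4 := by rw [← e]
  have h14 := mul_le_mul_of_nonneg_left h11 (by positivity : 0 ≤ s)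
  have h15 := mul_le_mul_of_nonneg_left h12 (by positivity : 0 ≤ 4 * s)
  have h16 : 0 ≤ s * (C * 2 * (q + q ^ 4)) := by positivity
  rw [e2, amplitudeConst]
  linarith

end IsAmplitude

/-! ### Stability for general densities -/

/-- Stability of the logarithmic Sobolev inequality in `W^{1,1}` for densities. -/
theorem stability_density {α : ℝ} {f : ℝ → ℝ} (h0 : ∀ᵐ x ∂γ, 0 ≤ f x)
    (hf : Integrable f γ) (hW : MemW1p 2 γ fun x => √(f x)) (h1 : ∫ x, f x ∂γ = 1)
    (hc : ∫ x, x * f x ∂γ = 0) (hi : Integrable (fun x => |x| ^ 2 * f x) γ)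
    (hα : ∫ x, |x| ^ 2 * f x ∂γ ≤ α) :
    Integrable (fisherIntegrand f) γ ∧ Integrable (fun x => f x * Real.log (f x)) γ ∧
      0 ≤ deficit f ∧ MemW1p 1 γ (fun x => f x - 1) ∧
      w11Norm γ (fun x => f x - 1) ≤ (4 * √(2 * Real.pi) + 1) * stabConst (|α| + 1) * 2 *
        (deficit f ^ (1 / 4 : ℝ) + deficit f ^ (3 / 4 : ℝ)) := by
  obtain ⟨-, w, hw, hw2⟩ := hW
  obtain ⟨v, hv, hp⟩ := hw.exists_isPrimitive
  rw [ae_γ_eq] at h0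
  have hvf : (fun x => v x ^ 2) =ᵐ[volume] f := by
    filter_upwards [hv, h0] with x hx hx0
    rw [hx, Real.sq_sqrt hx0]
  have toγ : ∀ {a b : ℝ → ℝ}, a =ᵐ[volume] b → a =ᵐ[γ] b := fun hab => by
    rwa [EventuallyEq, ae_γ_eq]
  simp only [sq_abs] at hi hα
  -- The absolutely continuous representative of √f serves as amplitude; |α| + 1 dominates α and is
  -- at least 1.
  have A : IsAmplitude v w (|α| + 1) :=
    { prim := hp
      integrable_sq := hf.congr (toγ hvf.symm)
      integrable_deriv_sq := hw2.integrable_sq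
      integral_sq := (integral_congr_ae (toγ hvf)).trans h1
      centered := (integral_congr_ae (toγ (by
        filter_upwards [hvf] with x hx; rw [hx]))).trans hc
      second_moment := hi.congr (toγ (by filter_upwards [hvf] with x hx; rw [← hx]))
      second_moment_le := by
        rw [integral_congr_ae (toγ (b := fun x => x ^ 2 * f x) (by
          filter_upwards [hvf] with x hx; rw [hx]))]
        linarith [le_abs_self α]
      one_le := by linarith [abs_nonneg α] }
  have hd := (A.isPrimitive_sq.hasWeakDeriv.congr hvf EventuallyEq.rfl).weakDeriv_ae_eq
  have hwd : HasWeakDeriv (fun x => f x - 1) (fun x => 2 * v x * w x) := by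
    have hp1 : IsPrimitive (fun x => v x ^ 2 - 1) (fun x => 2 * v x * w x) := by
      simpa only [sub_zero] using A.isPrimitive_sq.sub (IsPrimitive.const 1)
    refine hp1.hasWeakDeriv.congr ?_ EventuallyEq.rfl
    filter_upwards [hvf] with x hx
    rw [hx]
  have hd1 := hwd.weakDeriv_ae_eq
  have hfis : (fun x => (2 * v x * w x) ^ 2 / v x ^ 2) =ᵐ[γ] fisherIntegrand f := toγ (by
    filter_upwards [hd, hvf] with x hx hx2
    rw [fisherIntegrand, hx, ← hx2])
  have hlog : (fun x => v x ^ 2 * Real.log (v x ^ 2)) =ᵐ[γ] fun x => f x * Real.log (f x) :=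
    toγ (by filter_upwards [hvf] with x hx; rw [hx])
  have hdef : deficit f = IsAmplitude.deficitSq v w := by
    rw [deficit, IsAmplitude.deficitSq, integral_congr_ae hfis, integral_congr_ae hlog]
  refine ⟨A.integrable_fisher.congr hfis, A.integrable_mul_log.congr hlog,
    hdef ▸ A.deficitSq_nonneg, ⟨memLp_one_iff_integrable.2 (hf.sub (integrable_const _)), _, hwd,
      memLp_one_iff_integrable.2 A.integrable_deriv⟩, ?_⟩
  have e1 : ∫ x, |f x - 1| ∂γ = ∫ x, |v x ^ 2 - 1| ∂γ :=
    integral_congr_ae (toγ (by filter_upwards [hvf] with x hx; rw [hx]))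
  have e2 : ∫ x, |weakDeriv (fun x => f x - 1) x| ∂γ = ∫ x, |2 * v x * w x| ∂γ :=
    integral_congr_ae (toγ (by filter_upwards [hd1] with x hx; rw [hx]))
  rw [w11Norm, e1, e2, hdef]
  exact A.w11_bound

/-! ### Dilation between γ and exp(-πx²) dx, and stability for amplitudes -/

section scaling

theorem sqrt_two_pi_pos : 0 < √(2 * Real.pi) := by positivity

theorem sq_sqrt_two_pi : √(2 * Real.pi) ^ 2 = 2 * Real.pi := Real.sq_sqrt (by positivity)

theorem γπ_eq_map : γπ = γ.map (fun x => x / √(2 * Real.pi)) := by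
  rw [γ, gaussianReal_map_div_const, gaussianReal_of_var_ne_zero, γπ]
  · congr 1
    ext x
    rw [gaussianPDF, gaussianPDFReal]
    have e : ((1 / NNReal.mk (√(2 * Real.pi) ^ 2) (sq_nonneg _) : NNReal) : ℝ) = 1 / (2 * Real.pi) := by
      rw [NNReal.coe_div, NNReal.coe_one, NNReal.coe_mk, sq_sqrt_two_pi]
    rw [e]
    have h1 : 2 * Real.pi * (1 / (2 * Real.pi)) = 1 := by field_simp
    rw [h1, Real.sqrt_one, inv_one, one_mul]
    congr 2
    field_simp
    simp
    ring
  · refine (div_pos one_pos ?_).ne'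
    rw [← NNReal.coe_pos, NNReal.coe_mk]
    positivity

theorem measurableEmbedding_div_sqrt_two_pi :
    MeasurableEmbedding fun x : ℝ => x / √(2 * Real.pi) := by
  simp only [div_eq_mul_inv]
  exact measurableEmbedding_mulRight₀ (inv_ne_zero sqrt_two_pi_pos.ne')

theorem integral_γπ (k : ℝ → ℝ) : ∫ x, k x ∂γπ = ∫ x, k (x / √(2 * Real.pi)) ∂γ := by
  rw [γπ_eq_map, measurableEmbedding_div_sqrt_two_pi.integral_map]

theorem integrable_γπ_iff {k : ℝ → ℝ} :
    Integrable k γπ ↔ Integrable (fun x => k (x / √(2 * Real.pi))) γ := by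
  rw [γπ_eq_map, measurableEmbedding_div_sqrt_two_pi.integrable_map_iff]
  rfl

theorem ae_γπ_eq : ae γπ = ae (volume : Measure ℝ) := by
  refine le_antisymm (withDensity_absolutelyContinuous _ _).ae_le ?_
  refine (withDensity_absolutelyContinuous' (by fun_prop) ?_).ae_le
  exact Eventually.of_forall fun x => (ENNReal.ofReal_pos.2 (Real.exp_pos _)).ne'

instance : IsProbabilityMeasure γπ := by
  rw [γπ_eq_map]
  exact Measure.isProbabilityMeasure_map (by fun_prop)

theorem IsPrimitive.comp_div {v w : ℝ → ℝ} (h : IsPrimitive v w) {c : ℝ} (hc : c ≠ 0) :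
    IsPrimitive (fun x => v (x / c)) (fun x => w (x / c) / c) := by
  have ii : ∀ a b, IntervalIntegrable (fun x => w (x / c) / c) volume a b := fun a b => by
    have h1 := (h.intervalIntegrable (a / c) (b / c)).comp_mul_right (c := c⁻¹)
    simp only [div_eq_mul_inv, inv_inv, inv_mul_cancel_right₀ hc] at h1 ⊢
    exact h1.mul_const _
  refine ⟨fun x => ⟨Ioc (x - 1) (x + 1), Ioc_mem_nhds (by linarith) (by linarith), (ii _ _).1⟩,
    fun a b => ?_⟩
  rw [intervalIntegral.integral_div, intervalIntegral.integral_comp_div _ hc, smul_eq_mul,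
    h.integral_eq_sub, mul_div_cancel_left₀ _ hc]

end scaling

/-- Stability of the logarithmic Sobolev inequality in `W^{1,1}` for amplitudes. -/
theorem stability_amplitude {α : ℝ} {u : ℝ → ℝ} (h0 : ∀ᵐ x ∂γπ, 0 ≤ u x)
    (hW : MemW1p 2 γπ u) (h1 : ∫ x, u x ^ 2 ∂γπ = 1) (hc : ∫ x, x * u x ^ 2 ∂γπ = 0)
    (hi : Integrable (fun x => |x| ^ 2 * u x ^ 2) γπ)
    (hα : ∫ x, |x| ^ 2 * u x ^ 2 ∂γπ ≤ α) :
    Integrable (fun x => u x ^ 2 * Real.log (u x ^ 2)) γπ ∧ 0 ≤ deficitStar u ∧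
      MemW1p 1 γπ (fun x => u x - 1) ∧
      w11Norm γπ (fun x => u x - 1) ≤ IsAmplitude.amplitudeConst (2 * Real.pi * |α| + 1) *
        (deficitStar u ^ (1 / 4 : ℝ) + deficitStar u) := by
  obtain ⟨hu2, w, hw, hw2⟩ := hW
  obtain ⟨v, hv, hp⟩ := hw.exists_isPrimitive
  rw [ae_γπ_eq] at h0
  have toγπ : ∀ {a b : ℝ → ℝ}, a =ᵐ[volume] b → a =ᵐ[γπ] b := fun hab => by
    rwa [EventuallyEq, ae_γπ_eq]
  simp only [sq_abs] at hi hα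
  have cpos := sqrt_two_pi_pos
  have csq := sq_sqrt_two_pi
  set c := √(2 * Real.pi) with hcdef
  have hpi := Real.pi_pos
  have i1 : Integrable (fun x => v x ^ 2) γπ :=
    hu2.integrable_sq.congr (toγπ (by filter_upwards [hv] with x hx; rw [hx]))
  have i2 : Integrable (fun x => w x ^ 2) γπ := hw2.integrable_sq
  have i3 : Integrable (fun x => x ^ 2 * v x ^ 2) γπ :=
    hi.congr (toγπ (by filter_upwards [hv] with x hx; rw [hx]))
  have e1 : ∫ x, v x ^ 2 ∂γπ = 1 :=
    (integral_congr_ae (toγπ (by filter_upwards [hv] with x hx; rw [hx]))).trans h1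
  have e2 : ∫ x, x * v x ^ 2 ∂γπ = 0 :=
    (integral_congr_ae (toγπ (by filter_upwards [hv] with x hx; rw [hx]))).trans hc
  have e3 : ∫ x, x ^ 2 * v x ^ 2 ∂γπ ≤ α := by
    rwa [integral_congr_ae (toγπ (b := fun x => x ^ 2 * u x ^ 2)
      (by filter_upwards [hv] with x hx; rw [hx]))]
  have hlog : (fun x => v x ^ 2 * Real.log (v x ^ 2)) =ᵐ[γπ]
      fun x => u x ^ 2 * Real.log (u x ^ 2) :=
    toγπ (by filter_upwards [hv] with x hx; rw [hx])
  rw [integrable_γπ_iff] at i1 i2 i3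
  rw [integral_γπ] at e1 e2 e3
  simp only [← hcdef] at i1 i2 i3 e1 e2 e3
  -- Dilation by c = √(2π) multiplies second moments by 2π and divides the derivative by c, so 1/π
  -- in the deficit becomes the factor 2 of `amplitude_bound`.
  have A : IsAmplitude (fun x => v (x / c)) (fun x => w (x / c) / c) (2 * Real.pi * |α| + 1) :=
    { prim := hp.comp_div cpos.ne'
      integrable_sq := i1
      integrable_deriv_sq := by
        simp only [div_pow]
        exact i2.div_const _
      integral_sq := e1
      centered := by
        have e : (fun x => x * v (x / c) ^ 2) = fun x => c * (x / c * v (x / c) ^ 2) := by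
          ext x; field_simp
        rw [e, integral_const_mul, e2, mul_zero]
      second_moment := by
        refine (i3.const_mul (c ^ 2)).congr (Eventually.of_forall fun x => ?_)
        simp only
        field_simp
      second_moment_le := by
        have e : (fun x => x ^ 2 * v (x / c) ^ 2) =
            fun x => c ^ 2 * ((x / c) ^ 2 * v (x / c) ^ 2) := by
          ext x; field_simp
        rw [e, integral_const_mul, csq]
        have := mul_le_mul_of_nonneg_left (e3.trans (le_abs_self α))
          (by positivity : 0 ≤ 2 * Real.pi)
        linarith
      one_le := by
        have : 0 ≤ 2 * Real.pi * |α| := by positivity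
        linarith }
  have hd : weakDeriv u =ᵐ[volume] w := hw.weakDeriv_ae_eq
  have hdef : deficitStar u = 2 * (∫ x, (w (x / c) / c) ^ 2 ∂γ) -
      ∫ x, v (x / c) ^ 2 * Real.log (v (x / c) ^ 2) ∂γ := by
    have d1 : ∫ x, weakDeriv u x ^ 2 ∂γπ = ∫ x, w (x / c) ^ 2 ∂γ := by
      rw [← integral_γπ fun x => w x ^ 2]
      exact integral_congr_ae (toγπ (by filter_upwards [hd] with x hx; rw [hx]))
    rw [deficitStar, d1, ← integral_congr_ae hlog, integral_γπ, ← hcdef]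
    simp only [div_pow]
    rw [integral_div, csq]
    field_simp
  obtain ⟨b1, b2⟩ := A.amplitude_bound hdef
  have hwd : HasWeakDeriv (fun x => u x - 1) w := by
    have hp1 : IsPrimitive (fun x => v x - 1) w := by
      simpa only [sub_zero] using hp.sub (IsPrimitive.const 1)
    refine hp1.hasWeakDeriv.congr ?_ EventuallyEq.rfl
    filter_upwards [hv] with x hx
    rw [hx]
  have hu1 : Integrable u γπ := hu2.integrable (by norm_num)
  refine ⟨(integrable_γπ_iff.2 A.integrable_mul_log).congr hlog, b1,
    ⟨memLp_one_iff_integrable.2 (hu1.sub (integrable_const _)), w, hwd,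
      hw2.mono_exponent (by norm_num)⟩, le_trans ?_ b2⟩
  rw [w11Norm]
  refine add_le_add ?_ (le_of_eq ?_)
  · rw [← integral_γπ fun x => |v x ^ 2 - 1|]
    refine integral_mono_ae (hu1.sub (integrable_const _)).abs
      (integrable_γπ_iff.2 (A.integrable_sq.sub (integrable_const _)).abs) ?_
    rw [EventuallyLE, ae_γπ_eq]
    filter_upwards [hv, h0] with x hx hx0
    have e : v x ^ 2 - 1 = (u x - 1) * (u x + 1) := by rw [hx]; ring
    rw [e, abs_mul, abs_of_nonneg (by linarith : 0 ≤ u x + 1)]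
    nlinarith [abs_nonneg (u x - 1)]
  · rw [integral_congr_ae (g := fun x => |w x|)
      (toγπ (by filter_upwards [hwd.weakDeriv_ae_eq] with x hx; rw [hx])), integral_γπ,
      ← integral_const_mul]
    simp only [← hcdef]
    refine integral_congr_ae (Eventually.of_forall fun x => ?_)
    simp only
    rw [abs_div, abs_of_pos cpos, mul_div_cancel₀ _ cpos.ne']

end LSIStability

theorem theorem1p1 :
    (∀ α : ℝ, ∃ a : ℝ, 0 < a ∧ ∀ f : ℝ → ℝ,
      (∀ᵐ x ∂LSIStability.γ, 0 ≤ f x) →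
      Integrable f LSIStability.γ →
      LSIStability.MemW1p 2 LSIStability.γ (fun x => Real.sqrt (f x)) →
      ∫ x, f x ∂LSIStability.γ = 1 →
      ∫ x, x * f x ∂LSIStability.γ = 0 →
      Integrable (fun x => |x| ^ 2 * f x) LSIStability.γ →
      ∫ x, |x| ^ 2 * f x ∂LSIStability.γ ≤ α →
        Integrable (LSIStability.fisherIntegrand f) LSIStability.γ ∧
        Integrable (fun x => f x * Real.log (f x)) LSIStability.γ ∧
        0 ≤ LSIStability.deficit f ∧
        LSIStability.MemW1p 1 LSIStability.γ (fun x => f x - 1) ∧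
        LSIStability.w11Norm LSIStability.γ (fun x => f x - 1) ≤
          a * (LSIStability.deficit f ^ (1 / 4 : ℝ) + LSIStability.deficit f ^ (3 / 4 : ℝ))) ∧
    (∀ α : ℝ, ∃ a : ℝ, 0 < a ∧ ∀ u : ℝ → ℝ,
      (∀ᵐ x ∂LSIStability.γπ, 0 ≤ u x) →
      LSIStability.MemW1p 2 LSIStability.γπ u →
      ∫ x, u x ^ 2 ∂LSIStability.γπ = 1 →
      ∫ x, x * u x ^ 2 ∂LSIStability.γπ = 0 →
      Integrable (fun x => |x| ^ 2 * u x ^ 2) LSIStability.γπ →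
      ∫ x, |x| ^ 2 * u x ^ 2 ∂LSIStability.γπ ≤ α →
        Integrable (fun x => u x ^ 2 * Real.log (u x ^ 2)) LSIStability.γπ ∧
        0 ≤ LSIStability.deficitStar u ∧
        LSIStability.MemW1p 1 LSIStability.γπ (fun x => u x - 1) ∧
        LSIStability.w11Norm LSIStability.γπ (fun x => u x - 1) ≤
          a * (LSIStability.deficitStar u ^ (1 / 4 : ℝ) + LSIStability.deficitStar u)) := by
  refine ⟨fun α => ⟨(4 * √(2 * Real.pi) + 1) * LSIStability.stabConst (|α| + 1) * 2, ?_,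
    fun f h0 hf hW h1 hc hi hα => LSIStability.stability_density h0 hf hW h1 hc hi hα⟩,
    fun α => ⟨LSIStability.IsAmplitude.amplitudeConst (2 * Real.pi * |α| + 1), ?_,
    fun u h0 hW h1 hc hi hα => LSIStability.stability_amplitude h0 hW h1 hc hi hα⟩⟩
  · have := LSIStability.stabConst_pos (|α| + 1)
    positivity
  · refine LSIStability.IsAmplitude.amplitudeConst_pos ?_
    have : 0 ≤ 2 * Real.pi * |α| := by positivity
    linarith
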